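/- Let $H$ be a separable Hilbert space, let $A\subseteq\mathcal B(H)$ be a separable C*-algebra, and let $(X,\mu)$, $(Y,\nu)$ be standard measure spaces, i.e. $\mu$ and $\nu$ are Radon measures with respect to some complete metrisable separable locally compact topologies on $X$ and $Y$. A function from a measure space into a Banach space $\mathcal E$ is called weakly measurable if its composition with every bounded linear functional on $\mathcal E$ is measurable (with respect to the completed measure). Let $CB(A)$ be the space of completely bounded linear maps $A\to A$, and let $\varphi:X\times Y\to CB(A)$ be bounded and pointwise measurable, i.e. $(x,y)\mapsto\varphi(x,y)(a)$ is weakly measurable for every $a\in A$. For $k\in L^2(Y\times X,A)$ let $T_k:L^2(X,H)\to L^2(Y,H)$ be the bounded operator $(T_k\xi)(y)=\int_X k(y,x)\xi(x)\,d\mu(x)$, and let $(\varphi\cdot k)(y,x)=\varphi(x,y)(k(y,x))$. The function $\varphi$ is a Schur $A$-multiplier if the map $S_\varphi:T_k\mapsto T_{\varphi\cdot k}$ on the operator space $\{T_k:k\in L^2(Y\times X,A)\}\subseteq\mathcal B(L^2(X,H),L^2(Y,H))$ is completely bounded. It has a weakly measurable representation if there are a separable Hilbert space $K$, a non-degenerate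 *-representation $\rho:A\to\mathcal B(K)$ and bounded weakly measurable functions $V:X\to\mathcal B(H,K)$, $W:Y\to\mathcal B(H,K)$ such that, for every $a\in A$, $\varphi(x,y)(a)=W(y)^*\rho(a)V(x)$ for almost all $(x,y)\in X\times Y$. A Hilbert $A$-bimodule is a right Hilbert $A$-module $\mathcal N$ (with $A$-valued inner product $\langle\cdot,\cdot\rangle_A$ linear in the second variable) together with a left action $a\cdot\xi=\theta(a)\xi$ given by a *-representation $\theta$ of $A$ by adjointable operators on $\mathcal N$; it is countably generated if the right $A$-linear combinations of some countable subset are dense. Consider the conditions: (i) there exist a countably generated Hilbert $A$-bimodule $\mathcal N$ and bounded weakly measurable functions $v:X\to\mathcal N$, $w:Y\to\mathcal N$ such that, for every $a\in A$, $\varphi(x,y)(a)=\langle w(y),a\cdot v(x)\rangle_A$ for almost all $(x,y)\in X\times Y$; (ii) $\varphi$ is a Schur $A$-multiplier possessing a weakly measurable representation. Then (i) implies (ii). If $A$ is finite-dimensional, then (i) and (ii) are equivalent. -/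

import Mathlib

open MeasureTheory TopologicalSpace

universe u

set_option linter.unusedSectionVars false

noncomputable section

namespace SchurMult

/-! ### Weak measurability -/

/-- A function `f` from a measure space into a Banach space is weakly measurable when `ℓ ∘ f` is
`μ`-measurable (measurable for the completion of `μ`) for every bounded linear functional `ℓ`. -/
def WeaklyMeasurable {Ω E : Type*} [MeasurableSpace Ω] [NormedAddCommGroup E] [NormedSpace ℂ E]
    (f : Ω → E) (μ : Measure Ω) : Prop :=
  ∀ ℓ : StrongDual ℂ E, AEMeasurable (fun ω => ℓ (f ω)) μ

/-- Pettis: weak measurability with values in a separable space is strong measurability. -/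
theorem WeaklyMeasurable.aestronglyMeasurable {Ω E : Type*} [MeasurableSpace Ω]
    [NormedAddCommGroup E] [NormedSpace ℂ E] [SeparableSpace E] {f : Ω → E} {μ : Measure Ω}
    (hf : WeaklyMeasurable f μ) : AEStronglyMeasurable f μ := by
  borelize E
  have : SecondCountableTopology E := UniformSpace.secondCountable_of_separable E
  choose F hF1 hF2 using fun n : ℕ => exists_dual_vector'' ℂ (denseSeq E n)
  have key : ∀ (x : E) (r : ℝ), (∀ n, ‖F n x‖ ≤ r) → ‖x‖ ≤ r := by
    intro x r h
    refine le_of_forall_pos_le_add fun ε hε => ?_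
    obtain ⟨n, hn⟩ := (denseRange_denseSeq E).exists_dist_lt x (half_pos hε)
    rw [dist_eq_norm] at hn
    have h1 : ‖denseSeq E n‖ ≤ ‖F n x‖ + ‖x - denseSeq E n‖ := by
      have e : F n (denseSeq E n) = F n x - F n (x - denseSeq E n) := by
        rw [map_sub]; abel
      have e2 : ‖F n (denseSeq E n)‖ = ‖denseSeq E n‖ := by rw [hF2]; simp
      rw [← e2, e]
      refine (norm_sub_le _ _).trans ?_
      gcongr
      exact ((F n).le_of_opNorm_le (hF1 n) _).trans (by simp)
    have h2 : ‖x‖ ≤ ‖denseSeq E n‖ + ‖x - denseSeq E n‖ := by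
      have := norm_add_le (denseSeq E n) (x - denseSeq E n)
      simpa using this
    linarith [h n]
  have hball : ∀ (c : E) (r : ℝ), NullMeasurableSet (f ⁻¹' Metric.closedBall c r) μ := by
    intro c r
    have e : f ⁻¹' Metric.closedBall c r = ⋂ n, {ω | ‖F n (f ω) - F n c‖ ≤ r} := by
      ext ω
      simp only [Set.mem_preimage, Metric.mem_closedBall, dist_eq_norm, Set.mem_iInter,
        Set.mem_ofPred_eq, ← map_sub]
      exact ⟨fun h n => ((F n).le_of_opNorm_le (hF1 n) _).trans (by simpa using h), key _ _⟩
    rw [e]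
    refine NullMeasurableSet.iInter fun n => ?_
    exact nullMeasurableSet_le ((hf (F n)).sub_const _).norm aemeasurable_const
  have hopen : ∀ U : Set E, IsOpen U → NullMeasurableSet (f ⁻¹' U) μ := by
    intro U hU
    have hN : ∀ x ∈ U, ∃ r > 0, Metric.closedBall x r ⊆ U := fun x hx =>
      Metric.nhds_basis_closedBall.mem_iff.1 (hU.mem_nhds hx)
    choose! r hr hrU using hN
    obtain ⟨T, hTU, hTc, hT⟩ := TopologicalSpace.countable_cover_nhdsWithin
      (f := fun x => Metric.closedBall x (r x)) (s := U)
      (fun x hx => mem_nhdsWithin_of_mem_nhds (Metric.closedBall_mem_nhds x (hr x hx)))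
    have e : U = ⋃ x ∈ T, Metric.closedBall x (r x) :=
      Set.Subset.antisymm hT (Set.iUnion₂_subset fun x hx => hrU x (hTU hx))
    rw [e, Set.preimage_iUnion₂]
    exact NullMeasurableSet.biUnion hTc fun x _ => hball x (r x)
  have hnull : NullMeasurable f μ := by
    have h : Measurable[(inferInstance : MeasurableSpace (NullMeasurableSpace Ω μ))] f :=
      measurable_of_isOpen hopen
    exact fun s hs => h hs
  exact hnull.aemeasurable.aestronglyMeasurable

/-! ### Completely bounded maps between concrete operator spaces -/

section CB

variable {H₁ K₁ H₂ K₂ : Type*}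
  [NormedAddCommGroup H₁] [InnerProductSpace ℂ H₁] [NormedAddCommGroup K₁] [InnerProductSpace ℂ K₁]
  [NormedAddCommGroup H₂] [InnerProductSpace ℂ H₂] [NormedAddCommGroup K₂] [InnerProductSpace ℂ K₂]

/-- The operator `H₁ⁿ → K₁ⁿ` between Hilbertian direct sums with operator matrix `T`. -/
def opMatrix {n : ℕ} (T : Matrix (Fin n) (Fin n) (H₁ →L[ℂ] K₁)) :
    PiLp 2 (fun _ : Fin n => H₁) →L[ℂ] PiLp 2 (fun _ : Fin n => K₁) :=
  (PiLp.continuousLinearEquiv 2 ℂ (fun _ : Fin n => K₁)).symm.toContinuousLinearMap ∘L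
    ContinuousLinearMap.pi fun i => ∑ j, T i j ∘L PiLp.proj 2 (fun _ : Fin n => H₁) j

/-- A linear map `f` between subspaces `E ⊆ B(H₁, K₁)` and `F ⊆ B(H₂, K₂)` (included through
`i` and `j`) is completely bounded if its matrix amplifications
`M_n(E) → M_n(F)` are bounded uniformly in `n`. -/
def CompletelyBounded {E F : Type*} [AddCommGroup E] [Module ℂ E] [AddCommGroup F] [Module ℂ F]
    (i : E → (H₁ →L[ℂ] K₁)) (j : F → (H₂ →L[ℂ] K₂)) (f : E →ₗ[ℂ] F) : Prop :=
  ∃ C : ℝ, ∀ (n : ℕ) (M : Matrix (Fin n) (Fin n) E),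
    ‖opMatrix (M.map fun e => j (f e))‖ ≤ C * ‖opMatrix (M.map i)‖

end CB

/-! ### Integral operators with operator-valued kernels -/

section Kernel

variable {H : Type*} [NormedAddCommGroup H] [InnerProductSpace ℂ H] [CompleteSpace H]
variable {X Y : Type*} [MeasurableSpace X] [MeasurableSpace Y]
  {μ : Measure X} {ν : Measure Y} [SFinite μ] [SFinite ν]

/-- The function `y ↦ ∫ k(y,x) ξ(x) dμ(x)`. -/
def kernelFun (μ : Measure X) (k : Y × X → (H →L[ℂ] H)) (ξ : X → H) (y : Y) : H :=
  ∫ x, k (y, x) (ξ x) ∂μ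

theorem lintegral_kernel_le {k : X → (H →L[ℂ] H)} {ξ : X → H}
    (hk : AEStronglyMeasurable k μ) (hξ : AEStronglyMeasurable ξ μ) :
    ∫⁻ x, ‖k x (ξ x)‖ₑ ∂μ ≤ (∫⁻ x, ‖k x‖ₑ ^ 2 ∂μ) ^ (1 / 2 : ℝ) * eLpNorm ξ 2 μ := by
  have h := ENNReal.lintegral_mul_le_Lp_mul_Lq μ (Real.HolderConjugate.two_two)
    hk.enorm hξ.enorm
  rw [eLpNorm_eq_lintegral_rpow_enorm_toReal (by norm_num) (by norm_num)]
  simp only [ENNReal.toReal_ofNat, ENNReal.rpow_ofNat] at h ⊢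
  exact (lintegral_mono fun x => (k x).le_opENorm (ξ x)).trans h

theorem aestronglyMeasurable_kernel {k : Y × X → (H →L[ℂ] H)} {ξ : X → H}
    (hk : AEStronglyMeasurable k (ν.prod μ)) (hξ : AEStronglyMeasurable ξ μ) :
    AEStronglyMeasurable (fun p : Y × X => k p (ξ p.2)) (ν.prod μ) :=
  (ContinuousLinearMap.id ℂ (H →L[ℂ] H)).aestronglyMeasurable_comp₂ hk hξ.comp_snd

theorem lintegral_kernel_sq {k : Y × X → (H →L[ℂ] H)} (hk : AEStronglyMeasurable k (ν.prod μ)) :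
    ∫⁻ y, ∫⁻ x, ‖k (y, x)‖ₑ ^ 2 ∂μ ∂ν = eLpNorm k 2 (ν.prod μ) ^ 2 := by
  rw [eLpNorm_eq_lintegral_rpow_enorm_toReal (by norm_num) (by norm_num)]
  simp only [ENNReal.toReal_ofNat, ENNReal.rpow_ofNat]
  rw [← ENNReal.rpow_natCast, ← ENNReal.rpow_mul, lintegral_prod _ (hk.enorm.pow_const 2)]
  norm_num

/-- For almost every `y` the integral defining `kernelFun` converges absolutely. -/
theorem ae_integrable_kernel {k : Y × X → (H →L[ℂ] H)} {ξ : X → H}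
    (hk : MemLp k 2 (ν.prod μ)) (hξ : MemLp ξ 2 μ) :
    ∀ᵐ y ∂ν, Integrable (fun x => k (y, x) (ξ x)) μ := by
  have h2 : ∀ᵐ y ∂ν, ∫⁻ x, ‖k (y, x)‖ₑ ^ 2 ∂μ < ⊤ := by
    refine ae_lt_top' (hk.1.enorm.pow_const 2).lintegral_prod_right' ?_
    rw [lintegral_kernel_sq hk.1]
    exact ENNReal.pow_ne_top hk.2.ne
  filter_upwards [h2, hk.1.prodMk_left, (aestronglyMeasurable_kernel hk.1 hξ.1).prodMk_left]
    with y hy hky hm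
  refine ⟨hm, (lintegral_kernel_le hky hξ.1).trans_lt ?_⟩
  exact ENNReal.mul_lt_top (ENNReal.rpow_lt_top_of_nonneg (by norm_num) hy.ne) hξ.2

theorem eLpNorm_kernelFun_le {k : Y × X → (H →L[ℂ] H)} {ξ : X → H}
    (hk : AEStronglyMeasurable k (ν.prod μ)) (hξ : AEStronglyMeasurable ξ μ) :
    eLpNorm (kernelFun μ k ξ) 2 ν ≤ eLpNorm k 2 (ν.prod μ) * eLpNorm ξ 2 μ := by
  rw [← ENNReal.rpow_le_rpow_iff (z := 2) (by norm_num), ENNReal.rpow_ofNat, ENNReal.rpow_ofNat,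
    mul_pow, ← lintegral_kernel_sq hk,
    eLpNorm_eq_lintegral_rpow_enorm_toReal (by norm_num) (by norm_num)]
  simp only [ENNReal.toReal_ofNat, ENNReal.rpow_ofNat]
  rw [← ENNReal.rpow_natCast, ← ENNReal.rpow_mul]
  norm_num
  rw [← lintegral_mul_const'' _ (hk.enorm.pow_const 2).lintegral_prod_right']
  refine lintegral_mono_ae ?_
  filter_upwards [hk.prodMk_left] with y hy
  have h : ‖kernelFun μ k ξ y‖ₑ ≤ _ :=
    (enorm_integral_le_lintegral_enorm _).trans (lintegral_kernel_le hy hξ)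
  refine (pow_le_pow_left' h 2).trans_eq ?_
  rw [mul_pow, ← ENNReal.rpow_natCast, ← ENNReal.rpow_mul]
  norm_num

theorem memLp_kernelFun {k : Y × X → (H →L[ℂ] H)} {ξ : X → H}
    (hk : MemLp k 2 (ν.prod μ)) (hξ : MemLp ξ 2 μ) : MemLp (kernelFun μ k ξ) 2 ν :=
  ⟨(aestronglyMeasurable_kernel hk.1 hξ.1).integral_prod_right',
    (eLpNorm_kernelFun_le hk.1 hξ.1).trans_lt (ENNReal.mul_lt_top hk.2 hξ.2)⟩

variable (A : NonUnitalStarSubalgebra ℂ (H →L[ℂ] H))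

theorem memLp_coe {A : NonUnitalStarSubalgebra ℂ (H →L[ℂ] H)} (k : Lp A 2 (ν.prod μ)) :
    MemLp (fun p => (k p : H →L[ℂ] H)) 2 (ν.prod μ) :=
  ⟨continuous_subtype_val.comp_aestronglyMeasurable (Lp.memLp k).1, (Lp.memLp k).2⟩

/-- The operator `T_k : L²(X, H) → L²(Y, H)`, `(T_k ξ)(y) = ∫ k(y,x) ξ(x) dμ(x)`, for
`k ∈ L²(Y × X, A)`. -/
def kernelOp (k : Lp A 2 (ν.prod μ)) : Lp H 2 μ →L[ℂ] Lp H 2 ν :=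
  LinearMap.mkContinuous
    { toFun := fun ξ => (memLp_kernelFun (memLp_coe k) (Lp.memLp ξ)).toLp
        (kernelFun μ (fun p => (k p : H →L[ℂ] H)) ξ)
      map_add' := fun ξ η => by
        rw [← MemLp.toLp_add]
        refine MemLp.toLp_congr _ _ ?_
        filter_upwards [ae_integrable_kernel (memLp_coe k) (Lp.memLp ξ),
          ae_integrable_kernel (memLp_coe k) (Lp.memLp η)] with y h1 h2
        rw [Pi.add_apply, kernelFun, kernelFun, kernelFun, ← integral_add h1 h2]
        refine integral_congr_ae ?_
        filter_upwards [Lp.coeFn_add ξ η] with x hx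
        rw [hx, Pi.add_apply, map_add]
      map_smul' := fun c ξ => by
        rw [RingHom.id_apply, ← MemLp.toLp_const_smul]
        refine MemLp.toLp_congr _ _ (Filter.Eventually.of_forall fun y => ?_)
        rw [Pi.smul_apply, kernelFun, kernelFun, ← integral_smul]
        refine integral_congr_ae ?_
        filter_upwards [Lp.coeFn_smul c ξ] with x hx
        rw [hx, Pi.smul_apply, map_smul] }
    ‖k‖ fun ξ => by
      rw [LinearMap.coe_mk, AddHom.coe_mk, Lp.norm_toLp, Lp.norm_def, Lp.norm_def,
        ← ENNReal.toReal_mul]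
      exact ENNReal.toReal_mono (ENNReal.mul_ne_top (Lp.memLp k).2.ne (Lp.memLp ξ).2.ne)
        (eLpNorm_kernelFun_le (memLp_coe k).1 (Lp.memLp ξ).1)

theorem kernelOp_apply_ae (k : Lp A 2 (ν.prod μ)) (ξ : Lp H 2 μ) :
    kernelOp A k ξ =ᵐ[ν] fun y => ∫ x, (k (y, x) : H →L[ℂ] H) (ξ x) ∂μ :=
  MemLp.coeFn_toLp (memLp_kernelFun (memLp_coe k) (Lp.memLp ξ))

theorem kernelOp_add (k l : Lp A 2 (ν.prod μ)) :
    kernelOp A (k + l) = kernelOp A k + kernelOp A l := by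
  ext1 ξ
  refine Lp.ext ?_
  have h := Measure.ae_ae_of_ae_prod (Lp.coeFn_add k l)
  rw [add_apply]
  filter_upwards [kernelOp_apply_ae A (k + l) ξ, kernelOp_apply_ae A k ξ,
    kernelOp_apply_ae A l ξ, Lp.coeFn_add (kernelOp A k ξ) (kernelOp A l ξ), h,
    ae_integrable_kernel (memLp_coe k) (Lp.memLp ξ),
    ae_integrable_kernel (memLp_coe l) (Lp.memLp ξ)] with y h1 h2 h3 h4 h5 h6 h7
  rw [h1, h4, Pi.add_apply, h2, h3, ← integral_add h6 h7]
  refine integral_congr_ae ?_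
  filter_upwards [h5] with x hx
  rw [hx]; rfl

theorem kernelOp_smul (c : ℂ) (k : Lp A 2 (ν.prod μ)) :
    kernelOp A (c • k) = c • kernelOp A k := by
  ext1 ξ
  refine Lp.ext ?_
  have h := Measure.ae_ae_of_ae_prod (Lp.coeFn_smul c k)
  have e : (c • kernelOp A k) ξ = c • kernelOp A k ξ := rfl
  rw [e]
  filter_upwards [kernelOp_apply_ae A (c • k) ξ, kernelOp_apply_ae A k ξ,
    Lp.coeFn_smul c (kernelOp A k ξ), h] with y h1 h2 h3 h4
  rw [h1, h3, Pi.smul_apply, h2, ← integral_smul]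
  refine integral_congr_ae ?_
  filter_upwards [h4] with x hx
  rw [hx]; rfl

variable (μ ν) in
/-- The linear map `k ↦ T_k` on `L²(Y × X, A)`. -/
def kernelOpₗ : Lp A 2 (ν.prod μ) →ₗ[ℂ] (Lp H 2 μ →L[ℂ] Lp H 2 ν) where
  toFun k := kernelOp A k
  map_add' := kernelOp_add A
  map_smul' := kernelOp_smul A

variable (μ ν) in
/-- The operator space `S₂(Y × X, A) = {T_k : k ∈ L²(Y × X, A)}` inside
`B(L²(X, H), L²(Y, H))`. -/
def S₂ : Submodule ℂ (Lp H 2 μ →L[ℂ] Lp H 2 ν) := LinearMap.range (kernelOpₗ μ ν A)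

end Kernel

/-! ### Schur `A`-multipliers -/

section Multiplier

variable {H : Type u} [NormedAddCommGroup H] [InnerProductSpace ℂ H] [CompleteSpace H]
variable {A : NonUnitalStarSubalgebra ℂ (H →L[ℂ] H)}

/-- The set `CB(A)` of completely bounded linear maps `A → A`, for `A ⊆ B(H)`. -/
structure CBMap (A : NonUnitalStarSubalgebra ℂ (H →L[ℂ] H)) where
  /-- the underlying linear map -/
  toLinearMap : A →ₗ[ℂ] A
  completelyBounded : CompletelyBounded (fun a : A => (a : H →L[ℂ] H))
    (fun a : A => (a : H →L[ℂ] H)) toLinearMap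

instance : CoeFun (CBMap A) fun _ => A → A := ⟨fun f => f.toLinearMap⟩

variable {X Y : Type*}

/-- `φ` is bounded: the operator norms of the maps `φ(x,y)` are uniformly bounded. -/
def IsBoundedFamily (φ : X → Y → CBMap A) : Prop :=
  ∃ M : ℝ, ∀ x y a, ‖φ x y a‖ ≤ M * ‖a‖

variable [MeasurableSpace X] [MeasurableSpace Y] {μ : Measure X} {ν : Measure Y}
  [SFinite μ] [SFinite ν]

/-- `φ` is pointwise measurable: `(x, y) ↦ φ(x,y)(a)` is weakly measurable for all `a ∈ A`. -/
def PointwiseMeasurable (μ : Measure X) (ν : Measure Y) (φ : X → Y → CBMap A) : Prop :=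
  ∀ a : A, WeaklyMeasurable (fun p : X × Y => φ p.1 p.2 a) (μ.prod ν)

theorem memLp_schurAction [SeparableSpace A] {φ : X → Y → CBMap A} (hb : IsBoundedFamily φ)
    (hm : PointwiseMeasurable μ ν φ) (k : Lp A 2 (ν.prod μ)) :
    MemLp (fun p : Y × X => φ p.2 p.1 (k p)) 2 (ν.prod μ) := by
  obtain ⟨M, hM⟩ := hb
  have hk := (Lp.memLp k).1
  refine MemLp.of_le_mul (c := M) (Lp.memLp k) ?_ (Filter.Eventually.of_forall fun p => hM _ _ _)
  have hφ : ∀ a : A, AEStronglyMeasurable (fun p : Y × X => φ p.2 p.1 a) (ν.prod μ) := fun a =>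
    (hm a).aestronglyMeasurable.prod_swap
  set s := hk.stronglyMeasurable_mk.approx with hs
  have hcont : ∀ p : Y × X, Continuous fun a : A => φ p.2 p.1 a := fun p =>
    AddMonoidHomClass.continuous_of_bound (φ p.2 p.1).toLinearMap M fun a => hM _ _ _
  have hsm : ∀ n, AEStronglyMeasurable (fun p : Y × X => φ p.2 p.1 (s n p)) (ν.prod μ) := by
    intro n
    have e : (fun p : Y × X => φ p.2 p.1 (s n p)) = fun p => ∑ a ∈ (s n).range,
        ((s n) ⁻¹' {a}).indicator (fun p : Y × X => φ p.2 p.1 a) p := by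
      funext p
      rw [Finset.sum_eq_single (s n p)]
      · simp
      · intro b _ hb
        exact Set.indicator_of_notMem (fun h => hb (by simpa using Eq.symm h)) _
      · intro h
        exact absurd ((s n).mem_range_self p) h
    rw [e]
    exact Finset.aestronglyMeasurable_fun_sum _ fun a _ =>
      (hφ a).indicator ((s n).measurableSet_fiber a)
  refine aestronglyMeasurable_of_tendsto_ae Filter.atTop hsm ?_
  filter_upwards [hk.ae_eq_mk] with p hp
  have h1 := hk.stronglyMeasurable_mk.tendsto_approx p
  rw [← hp] at h1
  exact ((hcont p).tendsto _).comp h1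

/-- The action `(φ · k)(y, x) = φ(x,y)(k(y,x))` on `L²(Y × X, A)`. -/
def schurAction [SeparableSpace A] {φ : X → Y → CBMap A} (hb : IsBoundedFamily φ)
    (hm : PointwiseMeasurable μ ν φ) (k : Lp A 2 (ν.prod μ)) : Lp A 2 (ν.prod μ) :=
  (memLp_schurAction hb hm k).toLp _

/-- `φ` is a Schur `A`-multiplier: it is bounded and pointwise measurable, and
`S_φ : S₂(Y × X, A) → S₂(Y × X, A)`, `S_φ(T_k) = T_{φ·k}`, is (well defined and) completely
bounded. -/
def IsSchurMultiplier [SeparableSpace A] (μ : Measure X) (ν : Measure Y) [SFinite μ] [SFinite ν]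
    (φ : X → Y → CBMap A) : Prop :=
  ∃ (hb : IsBoundedFamily φ) (hm : PointwiseMeasurable μ ν φ) (S : S₂ μ ν A →ₗ[ℂ] S₂ μ ν A),
    (∀ k : Lp A 2 (ν.prod μ),
      S ⟨kernelOp A k, k, rfl⟩ = ⟨kernelOp A (schurAction hb hm k), _, rfl⟩) ∧
    CompletelyBounded (fun T : S₂ μ ν A => (T : Lp H 2 μ →L[ℂ] Lp H 2 ν))
      (fun T : S₂ μ ν A => (T : Lp H 2 μ →L[ℂ] Lp H 2 ν)) S

/-- A representation `φ(x,y)(a) = W(y)* ρ(a) V(x)` a.e. (for every `a`), with `ρ` a non-degenerate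
*-representation of `A` on a separable Hilbert space `K` and `V`, `W` bounded and weakly
measurable as functions into the Banach space `B(H, K)`. -/
def HasWeaklyMeasurableRepresentation (μ : Measure X) (ν : Measure Y)
    (φ : X → Y → CBMap A) : Prop :=
  ∃ (K : Type u) (_ : NormedAddCommGroup K) (_ : InnerProductSpace ℂ K) (_ : CompleteSpace K)
    (_ : SeparableSpace K) (ρ : A →⋆ₙₐ[ℂ] (K →L[ℂ] K)) (V : X → (H →L[ℂ] K)) (W : Y → (H →L[ℂ] K)),
    Dense (Submodule.span ℂ {ζ : K | ∃ a ξ, ζ = ρ a ξ} : Set K) ∧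
    (∃ M : ℝ, ∀ x, ‖V x‖ ≤ M) ∧ (∃ M : ℝ, ∀ y, ‖W y‖ ≤ M) ∧
    WeaklyMeasurable V μ ∧ WeaklyMeasurable W ν ∧
    ∀ a : A, ∀ᵐ p ∂(μ.prod ν),
      (φ p.1 p.2 a : H →L[ℂ] H) =
        (ContinuousLinearMap.adjoint (W p.2)) ∘L (ρ a) ∘L (V p.1)

/-! ### Hilbert bimodules -/

/-- The data making a Banach space `N` a Hilbert `A`-bimodule, for a concrete C*-algebra
`A ⊆ B(H)`: a right Hilbert `A`-module structure (with `A`-valued inner product linear in the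
second variable and inducing the norm of `N`) together with a *-representation of `A` by
adjointable operators on `N`. (Mathlib's `CStarModule` encodes left modules.) -/
structure HilbertBimodule (A : NonUnitalStarSubalgebra ℂ (H →L[ℂ] H)) (N : Type*)
    [NormedAddCommGroup N] [NormedSpace ℂ N] where
  /-- the right action `x · b` -/
  rsmul : N →ₗ[ℂ] A →ₗ[ℂ] N
  /-- the `A`-valued inner product -/
  inner : N → N → A
  /-- the left action `a · x` -/
  lsmul : A →ₗ[ℂ] N →ₗ[ℂ] N
  rsmul_mul : ∀ x a b, rsmul x (a * b) = rsmul (rsmul x a) b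
  inner_add_right : ∀ x y z, inner x (y + z) = inner x y + inner x z
  inner_smul_right : ∀ (c : ℂ) (x y), inner x (c • y) = c • inner x y
  inner_rsmul_right : ∀ x y a, inner x (rsmul y a) = inner x y * a
  star_inner : ∀ x y, star (inner x y) = inner y x
  inner_self_nonneg : ∀ x, (inner x x : H →L[ℂ] H).IsPositive
  norm_sq_eq : ∀ x, ‖x‖ ^ 2 = ‖inner x x‖
  lsmul_mul : ∀ a b x, lsmul (a * b) x = lsmul a (lsmul b x)
  inner_lsmul_left : ∀ a x y, inner (lsmul a x) y = inner x (lsmul (star a) y)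

/-- `N` is countably generated: the right `A`-linear combinations of some countable subset
are dense. -/
def HilbertBimodule.CountablyGenerated {N : Type*} [NormedAddCommGroup N] [NormedSpace ℂ N]
    (B : HilbertBimodule A N) : Prop :=
  ∃ s : Set N, s.Countable ∧
    Dense (Submodule.span ℂ {z : N | ∃ x ∈ s, ∃ a : A, z = B.rsmul x a} : Set N)

/-- A representation `φ(x,y)(a) = ⟨w(y), a · v(x)⟩` a.e. (for every `a`), with `v`, `w` bounded
weakly measurable functions into a countably generated Hilbert `A`-bimodule. -/
def HasBimoduleRepresentation (μ : Measure X) (ν : Measure Y) (φ : X → Y → CBMap A) : Prop :=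
  ∃ (N : Type u) (_ : NormedAddCommGroup N) (_ : NormedSpace ℂ N) (_ : CompleteSpace N)
    (B : HilbertBimodule A N) (v : X → N) (w : Y → N),
    B.CountablyGenerated ∧
    (∃ M : ℝ, ∀ x, ‖v x‖ ≤ M) ∧ (∃ M : ℝ, ∀ y, ‖w y‖ ≤ M) ∧
    WeaklyMeasurable v μ ∧ WeaklyMeasurable w ν ∧
    ∀ a : A, ∀ᵐ p ∂(μ.prod ν), φ p.1 p.2 a = B.inner (w p.2) (B.lsmul a (v p.1))

end Multiplier

end SchurMult

end

/-!
Let `N` be a Hilbert `A`-bimodule with `φ(x,y)(a) = ⟨w(y), a · v(x)⟩`. The interior tensor product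
`K = N ⊗_A H` turns the module elements into creation operators `L x : ξ ↦ x ⊗ ξ` from `H` to `K`,
with `(L x)* L y = ⟨x, y⟩`, and the left action into a representation `ρ` of `A` on `K`; hence
`φ(x,y)(a) = W(y)* ρ(a) V(x)` with `V = L ∘ v` and `W = L ∘ w`. Here `K` is the reproducing kernel
Hilbert space of the `B(H)`-valued kernel `⟨x, y⟩` on `N` (`HilbertBimodule.exists_interiorTensor`).
The Gram matrices are positive operators because they are positive on columns over `A`, and the
negative part of a matrix over `A` again has entries in `A` (`re_sum_inner_nonneg_of_conj`). The
left action is bounded on `K` because `‖a‖² - a*a` is the square of `‖a‖ + c` for a self-adjoint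
`c ∈ A` (`exists_inducedRepresentation`). Restriction to the essential subspace makes `ρ`
nondegenerate.

Given such a representation, `T_{φ·k} = W* T_{ρ∘k} V`, where `V` and `W` act pointwise on `L²`. So
`S_φ` is completely bounded as soon as `T_k ↦ T_{ρ∘k}` is completely contractive
(`norm_sum_inner_kernelOp_repKernel_le`). With respect to orthonormal bases of `L²(X)` and `L²(Y)`,
the finite compressions of `T_k` are matrices over `A`, those of `T_{ρ∘k}` are their images under
`ρ`, and amplifications of *-homomorphisms are contractive. The estimate also shows that
`T_k ↦ T_{φ·k}` is well defined.

Conversely, let `A` be finite-dimensional. It acts faithfully on a finite-dimensional invariant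
subspace of `H`, with orthonormal basis `(e_k)`, and `τ(a) = ∑ ⟨e_k, a e_k⟩` is a faithful trace on
`A`. The columns `(a e_k)_k ∈ H^m` realise `L²(A, τ)`; its left and right multiplications are each
other's commutants. Right multiplication by `c` is given on columns by the scalar matrix of `c`,
which also acts on `K^m`, and the operators `L²(A, τ) → K^m` intertwining the two right actions form
a Hilbert `A`-bimodule: `S*T` commutes with right multiplications, hence is the left multiplication
by an element of `A`, which is `⟨S, T⟩` (`StandardForm.homBimodule`). An operator `S : H → K` acts
on columns entrywise and so gives an element `Ŝ` of this bimodule, and `⟨Ŵ, a · V̂⟩ = W* ρ(a) V`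
whenever the right-hand side lies in `A`.
-/

noncomputable section

namespace SchurMult

/-! ### Operator matrices and their compressions -/

section Instances

-- Shortcuts: each of these instances is expensive to find on the coercion of a subalgebra of
-- `H →L[ℂ] H` to a type.

variable {H : Type*} [NormedAddCommGroup H] [InnerProductSpace ℂ H] [CompleteSpace H]
  (A : NonUnitalStarSubalgebra ℂ (H →L[ℂ] H))

scoped instance : NonUnitalNonAssocSemiring A := inferInstance
scoped instance : AddCommGroup A := inferInstance
scoped instance : AddCommMonoid A := inferInstance
scoped instance : AddGroup A := inferInstance
scoped instance : AddMonoid A := inferInstance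
scoped instance : AddZeroClass A := inferInstance
scoped instance : Add A := inferInstance
scoped instance : Mul A := inferInstance

end Instances

section Block

variable {E F : Type*} [NormedAddCommGroup E] [InnerProductSpace ℂ E]
  [NormedAddCommGroup F] [InnerProductSpace ℂ F]
  {ι κ : Type*} [Fintype ι] [DecidableEq ι] [Fintype κ]

/-- The inclusion of `E` as the `i`-th summand of the Hilbertian direct sum `E^ι`. -/
def piSingle (i : ι) : E →L[ℂ] PiLp 2 (fun _ : ι => E) :=
  (PiLp.continuousLinearEquiv 2 ℂ (fun _ : ι => E)).symm.toContinuousLinearMap ∘L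
    ContinuousLinearMap.single ℂ (fun _ : ι => E) i

theorem piSingle_apply (i j : ι) (x : E) :
    piSingle i x j = (Pi.single i x : ι → E) j := rfl

theorem inner_piSingle (i : ι) (x : E) (z : PiLp 2 (fun _ : ι => E)) :
    inner ℂ (piSingle i x) z = inner ℂ x (z i) := by
  rw [PiLp.inner_apply, Finset.sum_eq_single i]
  · simp [piSingle_apply]
  · intro j _ hj
    simp [piSingle_apply, hj]
  · simp

theorem sum_piSingle (z : PiLp 2 (fun _ : ι => E)) : ∑ i, piSingle i (z i) = z := by
  ext j
  rw [WithLp.ofLp_sum, Finset.sum_apply, Finset.sum_eq_single j]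
  · simp [piSingle_apply]
  · intro i _ hi
    simp [piSingle_apply, hi.symm]
  · simp

/-- The `(i, j)` entry of an operator on a Hilbertian direct sum. -/
def entry (T : PiLp 2 (fun _ : ι => E) →L[ℂ] PiLp 2 (fun _ : ι => F)) (i j : ι) : E →L[ℂ] F :=
  PiLp.proj 2 (fun _ : ι => F) i ∘L T ∘L piSingle j

theorem entry_apply (T : PiLp 2 (fun _ : ι => E) →L[ℂ] PiLp 2 (fun _ : ι => F)) (i j : ι) (x : E) :
    entry T i j x = T (piSingle j x) i := rfl

theorem apply_eq_sum_entry (T : PiLp 2 (fun _ : ι => E) →L[ℂ] PiLp 2 (fun _ : ι => F))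
    (z : PiLp 2 (fun _ : ι => E)) (i : ι) : T z i = ∑ j, entry T i j (z j) := by
  conv_lhs => rw [← sum_piSingle z, map_sum]
  rw [WithLp.ofLp_sum, Finset.sum_apply]
  rfl

theorem ext_entry {S T : PiLp 2 (fun _ : ι => E) →L[ℂ] PiLp 2 (fun _ : ι => F)}
    (h : ∀ i j, entry S i j = entry T i j) : S = T := by
  ext z i
  rw [apply_eq_sum_entry, apply_eq_sum_entry]
  simp only [h]

theorem inner_apply_eq_sum_entry (T : PiLp 2 (fun _ : ι => E) →L[ℂ] PiLp 2 (fun _ : ι => F))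
    (z : PiLp 2 (fun _ : ι => E)) (w : PiLp 2 (fun _ : ι => F)) :
    inner ℂ w (T z) = ∑ i, ∑ j, inner ℂ (w i) (entry T i j (z j)) := by
  rw [PiLp.inner_apply]
  simp only [apply_eq_sum_entry T z, inner_sum]

theorem entry_add (S T : PiLp 2 (fun _ : ι => E) →L[ℂ] PiLp 2 (fun _ : ι => F)) (i j : ι) :
    entry (S + T) i j = entry S i j + entry T i j := rfl

theorem entry_smul (c : ℂ) (T : PiLp 2 (fun _ : ι => E) →L[ℂ] PiLp 2 (fun _ : ι => F)) (i j : ι) :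
    entry (c • T) i j = c • entry T i j := rfl

theorem entry_zero (i j : ι) :
    entry (0 : PiLp 2 (fun _ : ι => E) →L[ℂ] PiLp 2 (fun _ : ι => F)) i j = 0 := rfl

theorem entry_mul (S T : PiLp 2 (fun _ : ι => E) →L[ℂ] PiLp 2 (fun _ : ι => E)) (i j : ι) :
    entry (S * T) i j = ∑ k, entry S i k * entry T k j := by
  ext x
  rw [entry_apply, mul_apply_eq_comp, apply_eq_sum_entry]
  simp [entry_apply]

theorem entry_star [CompleteSpace E]
    (T : PiLp 2 (fun _ : ι => E) →L[ℂ] PiLp 2 (fun _ : ι => E)) (i j : ι) :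
    entry (star T) i j = star (entry T j i) := by
  ext x
  refine ext_inner_left ℂ fun y => ?_
  rw [ContinuousLinearMap.star_eq_adjoint, ContinuousLinearMap.star_eq_adjoint,
    ContinuousLinearMap.adjoint_inner_right, entry_apply, entry_apply, ← inner_piSingle,
    ContinuousLinearMap.adjoint_inner_right, ← inner_conj_symm, inner_piSingle, inner_conj_symm]

theorem continuous_entry (i j : ι) : Continuous fun
    T : PiLp 2 (fun _ : ι => E) →L[ℂ] PiLp 2 (fun _ : ι => F) => entry T i j := by
  unfold entry
  fun_prop

/-- The operator on a Hilbertian direct sum with prescribed entries. -/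
def ofEntries (a : ι → ι → (E →L[ℂ] F)) :
    PiLp 2 (fun _ : ι => E) →L[ℂ] PiLp 2 (fun _ : ι => F) :=
  (PiLp.continuousLinearEquiv 2 ℂ (fun _ : ι => F)).symm.toContinuousLinearMap ∘L
    ContinuousLinearMap.pi fun i => ∑ j, a i j ∘L PiLp.proj 2 (fun _ : ι => E) j

theorem ofEntries_apply (a : ι → ι → (E →L[ℂ] F)) (z : PiLp 2 (fun _ : ι => E)) (i : ι) :
    ofEntries a z i = ∑ j, a i j (z j) := by
  simp [ofEntries]

theorem entry_ofEntries (a : ι → ι → (E →L[ℂ] F)) (i j : ι) : entry (ofEntries a) i j = a i j := by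
  ext x
  rw [entry_apply, ofEntries_apply, Finset.sum_eq_single j]
  · simp [piSingle_apply]
  · intro k _ hk
    simp [piSingle_apply, hk]
  · simp

theorem opMatrix_eq_ofEntries {n : ℕ} (T : Matrix (Fin n) (Fin n) (E →L[ℂ] F)) :
    opMatrix T = ofEntries T := rfl

end Block

section Amplification

variable {H : Type*} [NormedAddCommGroup H] [InnerProductSpace ℂ H] [CompleteSpace H]
  {K : Type*} [NormedAddCommGroup K] [InnerProductSpace ℂ K] [CompleteSpace K]

/-- The operators on `H^ι` whose entries lie in `A`; this is `M_ι(A)` with its operator norm. -/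
def blockAlgebra (ι : Type*) [Fintype ι] [DecidableEq ι]
    (A : NonUnitalStarSubalgebra ℂ (H →L[ℂ] H)) :
    NonUnitalStarSubalgebra ℂ (PiLp 2 (fun _ : ι => H) →L[ℂ] PiLp 2 (fun _ : ι => H)) where
  carrier := {T | ∀ i j, entry T i j ∈ A}
  add_mem' hS hT i j := by
    rw [entry_add]; exact add_mem (hS i j) (hT i j)
  zero_mem' i j := by
    rw [entry_zero]; exact zero_mem A
  mul_mem' hS hT i j := by
    rw [entry_mul]; exact sum_mem fun k _ => mul_mem (hS i k) (hT k j)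
  smul_mem' c T hT i j := by
    rw [entry_smul]; exact SMulMemClass.smul_mem c (hT i j)
  star_mem' hT i j := by
    rw [entry_star]; exact star_mem (hT j i)

variable {ι κ : Type*} [Fintype ι] [DecidableEq ι] [Fintype κ]
  {A : NonUnitalStarSubalgebra ℂ (H →L[ℂ] H)}

theorem mem_blockAlgebra {T : PiLp 2 (fun _ : ι => H) →L[ℂ] PiLp 2 (fun _ : ι => H)} :
    T ∈ blockAlgebra ι A ↔ ∀ i j, entry T i j ∈ A := Iff.rfl

theorem isClosed_blockAlgebra (hA : IsClosed (A : Set (H →L[ℂ] H))) :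
    IsClosed (blockAlgebra ι A : Set (PiLp 2 (fun _ : ι => H) →L[ℂ] PiLp 2 (fun _ : ι => H))) := by
  have : (blockAlgebra ι A : Set (PiLp 2 (fun _ : ι => H) →L[ℂ] PiLp 2 (fun _ : ι => H))) =
      ⋂ i, ⋂ j, (fun T => entry T i j) ⁻¹' (A : Set (H →L[ℂ] H)) := by
    ext T; simp [mem_blockAlgebra]
  rw [this]
  exact isClosed_iInter fun i => isClosed_iInter fun j => hA.preimage (continuous_entry i j)

set_option synthInstance.maxHeartbeats 400000 in
/-- The amplification `M_ι(A) → B(K^ι)` of a *-representation, applied entrywise. -/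
def amplification (ι : Type*) [Fintype ι] [DecidableEq ι] (ρ : A →⋆ₙₐ[ℂ] (K →L[ℂ] K)) :
    blockAlgebra ι A →⋆ₙₐ[ℂ] (PiLp 2 (fun _ : ι => K) →L[ℂ] PiLp 2 (fun _ : ι => K)) where
  toFun T := ofEntries fun i j => ρ ⟨entry T.1 i j, T.2 i j⟩
  map_smul' c T := ext_entry fun i j => by
    simp only [MonoidHom.id_apply]
    rw [entry_smul, entry_ofEntries, entry_ofEntries, ← map_smul]; rfl
  map_zero' := ext_entry fun i j => by
    rw [entry_ofEntries, entry_zero, ← map_zero ρ]; rfl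
  map_add' S T := ext_entry fun i j => by
    rw [entry_add, entry_ofEntries, entry_ofEntries, entry_ofEntries, ← map_add]; rfl
  map_mul' S T := ext_entry fun i j => by
    rw [entry_mul, entry_ofEntries]
    simp only [entry_ofEntries, ← map_mul]
    rw [← map_sum]
    congr 1
    ext1
    simp [entry_mul]
  map_star' T := ext_entry fun i j => by
    rw [entry_star, entry_ofEntries, entry_ofEntries, ← map_star]
    congr 1
    ext1
    simp [entry_star]

/-- The amplifications of a *-representation of a C*-algebra are contractive, being *-homomorphisms
on the C*-algebra of matrices. -/
theorem norm_ofEntries_map_le (hA : IsClosed (A : Set (H →L[ℂ] H))) (ρ : A →⋆ₙₐ[ℂ] (K →L[ℂ] K))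
    (a : ι → ι → A) :
    ‖ofEntries fun i j => ρ (a i j)‖ ≤ ‖ofEntries fun i j => (a i j : H →L[ℂ] H)‖ := by
  have : IsClosed (blockAlgebra ι A :
    Set (PiLp 2 (fun _ : ι => H) →L[ℂ] PiLp 2 (fun _ : ι => H))) := isClosed_blockAlgebra hA
  let T : blockAlgebra ι A := ⟨ofEntries fun i j => (a i j : H →L[ℂ] H), fun i j => by
    rw [entry_ofEntries]; exact (a i j).2⟩
  have e : (ofEntries fun i j => ρ (a i j)) = amplification ι ρ T := by
    refine ext_entry fun i j => ?_
    change _ = entry (ofEntries _) i j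
    rw [entry_ofEntries, entry_ofEntries]
    congr 1
    ext1
    exact (entry_ofEntries (fun i j => (a i j : H →L[ℂ] H)) i j).symm
  rw [e]
  exact NonUnitalStarAlgHom.norm_apply_le (amplification ι ρ) T

theorem norm_toLp_eq {E : Type*} [NormedAddCommGroup E] (z : κ → E) :
    ‖(WithLp.toLp 2 z : PiLp 2 (fun _ : κ => E))‖ = √(∑ i, ‖z i‖ ^ 2) := by
  rw [PiLp.norm_eq_of_L2]

/-- The norm of an operator matrix is the norm of its sesquilinear form. -/
theorem norm_ofEntries_le {E F : Type*} [NormedAddCommGroup E] [InnerProductSpace ℂ E]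
    [NormedAddCommGroup F] [InnerProductSpace ℂ F] (a : ι → ι → (E →L[ℂ] F)) {D : ℝ} (hD : 0 ≤ D)
    (h : ∀ (θ : ι → F) (ζ : ι → E), ‖∑ i, ∑ j, inner ℂ (θ i) (a i j (ζ j))‖ ≤
      D * √(∑ i, ‖θ i‖ ^ 2) * √(∑ j, ‖ζ j‖ ^ 2)) : ‖ofEntries a‖ ≤ D := by
  refine ContinuousLinearMap.opNorm_le_bound _ hD fun z => ?_
  have h1 := h (ofEntries a z) z
  have e : ∀ z w, inner ℂ w (ofEntries a z) = ∑ i, ∑ j, inner ℂ (w i) (a i j (z j)) := by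
    intro z w
    rw [inner_apply_eq_sum_entry]; simp only [entry_ofEntries]
  rw [← e, ← PiLp.norm_eq_of_L2, ← PiLp.norm_eq_of_L2, inner_self_eq_norm_sq_to_K] at h1
  simp only [norm_pow, RCLike.norm_ofReal, abs_norm] at h1
  rcases (norm_nonneg (ofEntries a z)).eq_or_lt with h0 | h0
  · rw [← h0]; positivity
  · nlinarith

theorem norm_sum_inner_le {E F : Type*} [NormedAddCommGroup E] [InnerProductSpace ℂ E]
    [NormedAddCommGroup F] [InnerProductSpace ℂ F] (a : ι → ι → (E →L[ℂ] F))
    (θ : ι → F) (ζ : ι → E) : ‖∑ i, ∑ j, inner ℂ (θ i) (a i j (ζ j))‖ ≤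
      ‖ofEntries a‖ * √(∑ i, ‖θ i‖ ^ 2) * √(∑ j, ‖ζ j‖ ^ 2) := by
  have e : ∑ i, ∑ j, inner ℂ (θ i) (a i j (ζ j)) =
      inner ℂ (WithLp.toLp 2 θ) (ofEntries a (WithLp.toLp 2 ζ)) := by
    rw [inner_apply_eq_sum_entry]; simp only [entry_ofEntries]
  rw [e, ← norm_toLp_eq, ← norm_toLp_eq, mul_comm ‖ofEntries a‖, mul_assoc]
  exact (norm_inner_le_norm _ _).trans (by gcongr; exact ContinuousLinearMap.le_opNorm _ _)

/-- A *-representation of a concrete C*-algebra is completely contractive, stated for rectangular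
matrices through the sesquilinear forms they define. -/
theorem norm_sum_inner_map_le (hA : IsClosed (A : Set (H →L[ℂ] H))) (ρ : A →⋆ₙₐ[ℂ] (K →L[ℂ] K))
    (a : κ → ι → A) {D : ℝ} (hD : 0 ≤ D)
    (h : ∀ (θ : κ → H) (ζ : ι → H), ‖∑ i, ∑ j, inner ℂ (θ i) ((a i j : H →L[ℂ] H) (ζ j))‖ ≤
      D * √(∑ i, ‖θ i‖ ^ 2) * √(∑ j, ‖ζ j‖ ^ 2)) (θ : κ → K) (ζ : ι → K) :
    ‖∑ i, ∑ j, inner ℂ (θ i) (ρ (a i j) (ζ j))‖ ≤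
      D * √(∑ i, ‖θ i‖ ^ 2) * √(∑ j, ‖ζ j‖ ^ 2) := by
  classical
  -- a rectangular matrix is a corner of a square one
  let b : (κ ⊕ ι) → (κ ⊕ ι) → A := fun p q => Sum.elim (fun i => Sum.elim (fun _ => 0) (a i) q)
    (fun _ => 0) p
  have hb : ‖ofEntries fun i j => (b i j : H →L[ℂ] H)‖ ≤ D := by
    refine norm_ofEntries_le _ hD fun θ ζ => ?_
    simp only [Fintype.sum_sum_type, b, Sum.elim_inl, Sum.elim_inr, ZeroMemClass.coe_zero,
      zero_apply, inner_zero_right, Finset.sum_const_zero, zero_add, add_zero]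
    refine (h _ _).trans ?_
    gcongr
    · simp only [le_add_iff_nonneg_right]; positivity
    · simp only [le_add_iff_nonneg_left]; positivity
  have h2 := (norm_sum_inner_le (fun i j => ρ (b i j)) (Sum.elim θ fun _ => 0)
    (Sum.elim (fun _ => 0) ζ))
  have h3 := (norm_ofEntries_map_le hA ρ b).trans hb
  simp only [Fintype.sum_sum_type, b, Sum.elim_inl, Sum.elim_inr, map_zero,
    zero_apply, inner_zero_right, Finset.sum_const_zero, zero_add, add_zero, norm_zero,
    ne_eq, OfNat.ofNat_ne_zero, not_false_eq_true, zero_pow] at h2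
  refine h2.trans ?_
  gcongr

end Amplification

/-! ### Positivity in concrete C*-algebras -/

section Positivity

variable {H : Type*} [NormedAddCommGroup H] [InnerProductSpace ℂ H] [CompleteSpace H]
  {ι : Type*} [Fintype ι]
  {A : NonUnitalStarSubalgebra ℂ (H →L[ℂ] H)}

/-- The reason is `⟨p, N³p⟩ = ‖√N N p‖²`. -/
theorem apply_eq_zero_of_cube {N : H →L[ℂ] H} (hN : 0 ≤ N) {p : H}
    (h : RCLike.re (inner ℂ p (N (N (N p)))) ≤ 0) : N p = 0 := by
  have hs : IsSelfAdjoint N := hN.isSelfAdjoint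
  have hs' : IsSelfAdjoint (CFC.sqrt N) := (CFC.sqrt_nonneg N).isSelfAdjoint
  have hsq : ∀ z, CFC.sqrt N (CFC.sqrt N z) = N z := fun z => by
    rw [← mul_apply_eq_comp, CFC.sqrt_mul_sqrt_self N hN]
  have symm : ∀ {S : H →L[ℂ] H}, IsSelfAdjoint S → ∀ x y, inner ℂ x (S y) = inner ℂ (S x) y := by
    intro S hS x y
    rw [ContinuousLinearMap.isSelfAdjoint_iff'] at hS
    rw [← ContinuousLinearMap.adjoint_inner_left, hS]
  have h1 : CFC.sqrt N (N p) = 0 := by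
    rw [symm hs, ← hsq (N p), symm hs', inner_self_eq_norm_sq (𝕜 := ℂ)] at h
    exact norm_eq_zero.1 (pow_eq_zero_iff two_ne_zero |>.1 (le_antisymm h (sq_nonneg _)))
  have h2 : N (N p) = 0 := by rw [← hsq (N p), h1, map_zero]
  have h3 : inner ℂ (N p) (N p) = 0 := by rw [← symm hs, h2, inner_zero_right]
  exact inner_self_eq_zero.1 h3

theorem negPart_conj {B : Type*} [CStarAlgebra B] [PartialOrder B] [StarOrderedRing B] {T : B}
    (hT : IsSelfAdjoint T) : T⁻ * T * T⁻ = -(T⁻ * T⁻ * T⁻) := by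
  have e : T⁻ * T = -(T⁻ * T⁻) := by
    calc T⁻ * T = T⁻ * (T⁺ - T⁻) := by rw [CFC.posPart_sub_negPart T hT]
      _ = _ := by rw [mul_sub, CFC.negPart_mul_posPart, zero_sub]
  rw [e, neg_mul]

theorem negPart_apply_eq_zero {T : H →L[ℂ] H} (hT : IsSelfAdjoint T) {p : H}
    (h : 0 ≤ RCLike.re (inner ℂ p ((T⁻ * T * T⁻) p))) : T⁻ p = 0 := by
  refine apply_eq_zero_of_cube (CFC.negPart_nonneg T) ?_
  rw [negPart_conj hT] at h
  simpa using h

set_option maxHeartbeats 1000000 in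
/-- A matrix over a concrete C*-algebra that is positive on columns over the algebra is positive as
an operator: its negative part `N` has entries in the algebra, so the columns of `N` are
admissible, and they give `-N³ ≥ 0` on the diagonal. -/
theorem re_sum_inner_nonneg_of_conj (hA : IsClosed (A : Set (H →L[ℂ] H))) (G : ι → ι → A)
    (hstar : ∀ i j, star (G i j) = G j i)
    (hG : ∀ a : ι → A, ((∑ i, ∑ j, star (a i) * G i j * a j : A) : H →L[ℂ] H).IsPositive)
    (ξ : ι → H) : 0 ≤ RCLike.re (∑ i, ∑ j, inner ℂ (ξ i) ((G i j : H →L[ℂ] H) (ξ j))) := by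
  classical
  set T := ofEntries fun i j => (G i j : H →L[ℂ] H) with hT
  have hTsa : IsSelfAdjoint T := ext_entry fun i j => by
    rw [entry_star, hT, entry_ofEntries, entry_ofEntries, ← hstar i j]
    simp
  have hTmem : T ∈ blockAlgebra ι A := fun i j => by
    rw [hT, entry_ofEntries]; exact (G i j).2
  have : IsClosed (blockAlgebra ι A :
    Set (PiLp 2 (fun _ : ι => H) →L[ℂ] PiLp 2 (fun _ : ι => H))) := isClosed_blockAlgebra hA
  have hNmem : T⁻ ∈ blockAlgebra ι A := by
    rw [CFC.negPart_def]
    exact cfcₙ_mem _ hTmem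
  have hN : 0 ≤ T⁻ := CFC.negPart_nonneg T
  have hNsa : IsSelfAdjoint T⁻ := hN.isSelfAdjoint
  have hcol : ∀ k x, T⁻ (piSingle k x) = 0 := by
    intro k x
    refine negPart_apply_eq_zero hTsa ?_
    let a : ι → A := fun j => ⟨entry T⁻ j k, hNmem j k⟩
    have e : entry (T⁻ * T * T⁻) k k = ((∑ i, ∑ j, star (a i) * G i j * a j : A) : H →L[ℂ] H) := by
      have h1 : ∀ i, star (entry T⁻ i k) = entry T⁻ k i := fun i => by
        rw [← entry_star, hNsa.star_eq]
      simp only [entry_mul, Finset.sum_mul, hT, entry_ofEntries, AddSubmonoidClass.coe_finsetSum,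
        MulMemClass.coe_mul, StarMemClass.coe_star, a]
      rw [Finset.sum_comm]
      simp only [← hT, h1]
    have h2 := (hG a).re_inner_nonneg_right x
    rwa [← e, entry_apply, ← inner_piSingle] at h2
  have hN0 : T⁻ = 0 := ext_entry fun i k => by
    ext x
    rw [entry_apply, hcol, entry_zero]; simp
  have hpos : 0 ≤ T := (CFC.negPart_eq_zero_iff T hTsa).1 hN0
  have := ((ContinuousLinearMap.nonneg_iff_isPositive T).1 hpos).re_inner_nonneg_right
    (WithLp.toLp 2 ξ)
  rw [inner_apply_eq_sum_entry] at this
  simpa only [hT, entry_ofEntries] using this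

/-- For `a ∈ A` the operator `‖a‖² - a*a` is the square of `‖a‖ + c` for some self-adjoint
`c ∈ A`. -/
theorem exists_mem_sq_add (hA : IsClosed (A : Set (H →L[ℂ] H))) (a : A) :
    ∃ c : A, star c = c ∧ (2 * ‖a‖ : ℂ) • c + c * c = -(star a * a) := by
  have := hA
  set b : H →L[ℂ] H := star (a : H →L[ℂ] H) * a with hb
  have hbmem : b ∈ A := mul_mem (star_mem a.2) a.2
  have hb0 : 0 ≤ b := star_mul_self_nonneg _
  have hbsa : IsSelfAdjoint b := hb0.isSelfAdjoint
  -- `c = √(‖a‖² - a*a) - ‖a‖`: subtracting `‖a‖` makes the function vanish at `0`, so that `c` lies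
  -- in `A`, which need not have a unit
  let f : ℝ → ℝ := fun s => √(‖a‖ ^ 2 - s) - ‖a‖
  have hf0 : f 0 = 0 := by simp [f, Real.sqrt_sq]
  have hfc : Continuous f := by fun_prop
  have hle : ∀ s ∈ quasispectrum ℝ b, s ≤ ‖a‖ ^ 2 := by
    intro s hs
    rw [quasispectrum_eq_spectrum_union_zero] at hs
    rcases hs with hs | hs
    · have h1 := spectrum.norm_le_norm_mul_of_mem hs
      rw [hb, CStarRing.norm_star_mul_self, ← pow_two] at h1
      have h2 : ‖(1 : H →L[ℂ] H)‖ ≤ 1 := ContinuousLinearMap.norm_id_le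
      refine (le_abs_self s).trans (h1.trans ?_)
      exact mul_le_of_le_one_right (by positivity) h2
    · rw [hs]; positivity
  have key : cfcₙ (fun s => (2 * ‖a‖) * f s + f s * f s) b = -b := by
    rw [cfcₙ_congr (g := fun s => -s), cfcₙ_neg_id (R := ℝ) b]
    intro s hs
    have : √(‖a‖ ^ 2 - s) ^ 2 = ‖a‖ ^ 2 - s := Real.sq_sqrt (sub_nonneg.2 (hle s hs))
    simp only [f]
    nlinarith
  rw [cfcₙ_add (fun s => (2 * ‖a‖) * f s) (fun s => f s * f s) b (by fun_prop) (by simp [hf0])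
    (by fun_prop) (by simp [hf0]), cfcₙ_const_mul _ f b (by fun_prop) hf0,
    cfcₙ_mul f f b (by fun_prop) hf0 (by fun_prop) hf0] at key
  refine ⟨⟨cfcₙ f b, cfcₙ_mem f hbmem⟩, ?_, ?_⟩
  · ext1
    exact (cfcₙ_predicate f b : IsSelfAdjoint _).star_eq
  · ext1
    refine Eq.trans ?_ key
    ext x
    simp only [AddMemClass.coe_add, SetLike.val_smul, MulMemClass.coe_mul, add_apply,
      smul_apply, ← Complex.coe_smul]
    push_cast
    rfl

end Positivity

/-! ### The interior tensor product as a reproducing kernel space -/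

section Tensor

variable {H : Type u} [NormedAddCommGroup H] [InnerProductSpace ℂ H] [CompleteSpace H]
  {A : NonUnitalStarSubalgebra ℂ (H →L[ℂ] H)}
  {N : Type u} [NormedAddCommGroup N] [NormedSpace ℂ N]

namespace HilbertBimodule

variable (B : HilbertBimodule A N)

theorem inner_add_left (x y z : N) : B.inner (x + y) z = B.inner x z + B.inner y z := by
  rw [← B.star_inner z, B.inner_add_right, star_add, B.star_inner, B.star_inner]

theorem inner_smul_left (c : ℂ) (x y : N) : B.inner (c • x) y = star c • B.inner x y := by
  rw [← B.star_inner y, B.inner_smul_right, star_smul, B.star_inner]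

theorem inner_rsmul_left (x y : N) (a : A) :
    B.inner (B.rsmul x a) y = star a * B.inner x y := by
  rw [← B.star_inner y, B.inner_rsmul_right, star_mul, B.star_inner]

theorem inner_sum_right {ι : Type*} (s : Finset ι) (x : N) (f : ι → N) :
    B.inner x (∑ i ∈ s, f i) = ∑ i ∈ s, B.inner x (f i) :=
  map_sum (AddMonoidHom.mk' (B.inner x) (B.inner_add_right x)) f s

theorem inner_sum_left {ι : Type*} (s : Finset ι) (x : N) (f : ι → N) :
    B.inner (∑ i ∈ s, f i) x = ∑ i ∈ s, B.inner (f i) x :=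
  map_sum (AddMonoidHom.mk' (B.inner · x) fun y z => B.inner_add_left y z x) f s

theorem norm_rsmul_le (x : N) (a : A) : ‖B.rsmul x a‖ ≤ ‖x‖ * ‖a‖ := by
  refine (pow_le_pow_iff_left₀ (by positivity) (by positivity) two_ne_zero).1 ?_
  rw [B.norm_sq_eq, B.inner_rsmul_right, B.inner_rsmul_left, mul_pow, B.norm_sq_eq x]
  refine (norm_mul_le _ _).trans ?_
  have h := norm_mul_le (star a) (B.inner x x)
  have hs : ‖star a‖ = ‖a‖ := norm_star (a : H →L[ℂ] H)
  rw [hs] at h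
  nlinarith [norm_nonneg a]

theorem separableSpace [SeparableSpace A] (h : B.CountablyGenerated) : SeparableSpace N := by
  obtain ⟨s, hs, hd⟩ := h
  have h1 : IsSeparable {z : N | ∃ x ∈ s, ∃ a : A, z = B.rsmul x a} := by
    have e : {z : N | ∃ x ∈ s, ∃ a : A, z = B.rsmul x a} =
        ⋃ x : s, Set.range fun a : A => B.rsmul x a := by
      ext z; simp [eq_comm]
    have := hs.to_subtype
    rw [e]
    refine IsSeparable.iUnion fun x => isSeparable_range ?_
    exact AddMonoidHomClass.continuous_of_bound (B.rsmul x) ‖(x : N)‖ (B.norm_rsmul_le x)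
  have h2 : IsSeparable (Set.univ : Set N) := by
    rw [← hd.closure_eq]
    exact (h1.span (R := ℂ)).closure
  exact isSeparable_univ_iff.1 h2

/-- Gram matrices of a Hilbert module are positive operators. -/
theorem re_sum_inner_nonneg (hA : IsClosed (A : Set (H →L[ℂ] H))) {ι : Type*} [Fintype ι]
    (x : ι → N) (ξ : ι → H) :
    0 ≤ RCLike.re (∑ i, ∑ j, Inner.inner ℂ (ξ i) ((B.inner (x i) (x j) : H →L[ℂ] H) (ξ j))) := by
  refine re_sum_inner_nonneg_of_conj hA (fun i j => B.inner (x i) (x j))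
    (fun i j => B.star_inner _ _) (fun a => ?_) ξ
  have e : (∑ i, ∑ j, star (a i) * B.inner (x i) (x j) * a j : A) =
      B.inner (∑ i, B.rsmul (x i) (a i)) (∑ i, B.rsmul (x i) (a i)) := by
    rw [B.inner_sum_left]
    refine Finset.sum_congr rfl fun i _ => ?_
    rw [B.inner_sum_right]
    refine Finset.sum_congr rfl fun j _ => ?_
    rw [B.inner_rsmul_left, B.inner_rsmul_right, mul_assoc]
  rw [e]
  exact B.inner_self_nonneg _

/-- The `B(H)`-valued kernel `(x, y) ↦ ⟨x, y⟩` on `N`. -/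
def gramKernel : Matrix N N (H →L[ℂ] H) := .of fun x y => (B.inner x y : H →L[ℂ] H)

theorem posSemidef_gramKernel (hA : IsClosed (A : Set (H →L[ℂ] H))) :
    B.gramKernel.PosSemidef := by
  have htfae := (RKHS.posSemidef_tfae (K := B.gramKernel)).out 0 2
  refine htfae.2 ⟨?_, fun f => ?_⟩
  · ext1 x y
    exact congrArg Subtype.val (B.star_inner y x)
  · have h := B.re_sum_inner_nonneg hA (ι := f.support) (fun i => i) (fun i => f i)
    simp only [Finsupp.sum]
    rw [Finset.sum_comm]
    simp only [map_sum] at h ⊢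
    refine h.trans_eq ((Finset.sum_coe_sort f.support fun i => ∑ j : f.support,
      RCLike.re (Inner.inner ℂ (f i) ((B.inner i j : H →L[ℂ] H) (f j)))).trans
      (Finset.sum_congr rfl fun i _ => (Finset.sum_coe_sort f.support fun j =>
      RCLike.re (Inner.inner ℂ (f i) ((B.inner i j : H →L[ℂ] H) (f j)))).trans
      (Finset.sum_congr rfl fun j _ => ?_)))
    rw [inner_re_symm]
    rfl

/-- The interior tensor product `N ⊗_A H`, given by the creation operators `L x : ξ ↦ x ⊗ ξ`. It is
the reproducing kernel Hilbert space of the kernel `⟨x, y⟩`. -/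
theorem exists_interiorTensor (hA : IsClosed (A : Set (H →L[ℂ] H))) :
    ∃ (K : Type u) (_ : NormedAddCommGroup K) (_ : InnerProductSpace ℂ K) (_ : CompleteSpace K)
      (L : N →ₗ[ℂ] (H →L[ℂ] K)),
      (∀ x y, ContinuousLinearMap.adjoint (L x) ∘L L y = B.inner x y) ∧
      Dense (Submodule.span ℂ {ζ : K | ∃ x ξ, ζ = L x ξ} : Set K) := by
  have : Fact B.gramKernel.PosSemidef := ⟨B.posSemidef_gramKernel hA⟩
  let K := RKHS.OfKernel B.gramKernel
  have hk : ∀ x y ξ η, Inner.inner ℂ (RKHS.kerFun K x ξ) (RKHS.kerFun K y η) =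
      Inner.inner ℂ ξ ((B.inner x y : H →L[ℂ] H) η) := by
    intro x y ξ η
    rw [← ContinuousLinearMap.adjoint_inner_right, ← ContinuousLinearMap.comp_apply,
      ← RKHS.kernel_apply, RKHS.OfKernel.kernel_ofKernel]
    rfl
  let L : N →ₗ[ℂ] (H →L[ℂ] K) :=
    { toFun := fun x => RKHS.kerFun K x
      map_add' := fun x y => by
        ext1 ξ
        rw [add_apply, ← sub_eq_zero, ← inner_self_eq_zero (𝕜 := ℂ)]
        simp only [inner_sub_left, inner_sub_right, _root_.inner_add_left, _root_.inner_add_right,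
          hk, B.inner_add_left, B.inner_add_right, AddMemClass.coe_add, add_apply]
        ring
      map_smul' := fun c x => by
        ext1 ξ
        rw [smul_apply, ← sub_eq_zero, ← inner_self_eq_zero (𝕜 := ℂ)]
        simp only [inner_sub_left, inner_sub_right, _root_.inner_smul_left,
          _root_.inner_smul_right, hk, B.inner_smul_left, B.inner_smul_right, SetLike.val_smul,
          smul_apply, RingHom.id_apply, RCLike.star_def]
        ring }
  refine ⟨K, inferInstance, inferInstance, inferInstance, L, fun x y => ?_, ?_⟩
  · ext1 η
    refine ext_inner_left ℂ fun ξ => ?_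
    rw [ContinuousLinearMap.comp_apply, ContinuousLinearMap.adjoint_inner_right]
    exact hk x y ξ η
  · have h := RKHS.kerFun_dense (H := K)
    rw [← Submodule.dense_iff_topologicalClosure_eq_top] at h
    have e : {ζ : K | ∃ x ξ, ζ = L x ξ} = {ζ : K | ∃ x ξ, RKHS.kerFun K x ξ = ζ} := by
      ext ζ; simp [L, eq_comm]
    rw [e]
    exact h

end HilbertBimodule

/-- Creation operators are isometric in the module element. -/
theorem norm_creation {K : Type*} [NormedAddCommGroup K] [InnerProductSpace ℂ K] [CompleteSpace K]
    (B : HilbertBimodule A N) {L : N →ₗ[ℂ] (H →L[ℂ] K)}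
    (hL : ∀ x y, ContinuousLinearMap.adjoint (L x) ∘L L y = B.inner x y) (x : N) :
    ‖L x‖ = ‖x‖ := by
  have h := ContinuousLinearMap.norm_adjoint_comp_self (L x)
  rw [hL] at h
  have h2 : ‖L x‖ ^ 2 = ‖x‖ ^ 2 := by
    rw [B.norm_sq_eq, pow_two, ← h]; rfl
  exact (pow_left_inj₀ (norm_nonneg _) (norm_nonneg _) two_ne_zero).1 h2

/-- The left action of `A` on a Hilbert bimodule induces a *-representation on the interior tensor
product. Its boundedness comes from `‖a‖² - a*a = (‖a‖ + c)²`. -/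
theorem exists_inducedRepresentation (hA : IsClosed (A : Set (H →L[ℂ] H)))
    {K : Type*} [NormedAddCommGroup K] [InnerProductSpace ℂ K] [CompleteSpace K]
    (B : HilbertBimodule A N) {L : N →ₗ[ℂ] (H →L[ℂ] K)}
    (hL : ∀ x y, ContinuousLinearMap.adjoint (L x) ∘L L y = B.inner x y)
    (hd : Dense (Submodule.span ℂ {ζ : K | ∃ x ξ, ζ = L x ξ} : Set K)) :
    ∃ ρ : A →⋆ₙₐ[ℂ] (K →L[ℂ] K), ∀ a x, ρ a ∘L L x = L (B.lsmul a x) := by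
  classical
  have hinner : ∀ x y ξ η, inner ℂ (L x ξ) (L y η) = inner ℂ ξ ((B.inner x y : H →L[ℂ] H) η) := by
    intro x y ξ η
    rw [← ContinuousLinearMap.adjoint_inner_right, ← ContinuousLinearMap.comp_apply, hL]
  -- `e` and `Φ a` are the maps `x ⊗ ξ ↦ x ⊗ ξ` and `x ⊗ ξ ↦ ax ⊗ ξ` on formal sums; once
  -- `‖Φ a f‖ ≤ ‖a‖ ‖e f‖` is known, `Φ a` factors through `e`
  let e : (N →₀ H) →ₗ[ℂ] K := Finsupp.lsum ℂ fun x => (L x).toLinearMap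
  let Φ : A → (N →₀ H) →ₗ[ℂ] K := fun a => Finsupp.lsum ℂ fun x => (L (B.lsmul a x)).toLinearMap
  have he : ∀ f, e f = f.sum fun x ξ => L x ξ := fun f => rfl
  have hΦ : ∀ a f, Φ a f = f.sum fun x ξ => L (B.lsmul a x) ξ := fun a f => rfl
  have hadd : ∀ a b f, Φ (a + b) f = Φ a f + Φ b f := fun a b f => by
    simp only [hΦ, map_add, add_apply, Finsupp.sum_add, LinearMap.add_apply]
  have hsmul : ∀ (c : ℂ) a f, Φ (c • a) f = c • Φ a f := fun c a f => by
    simp only [hΦ, map_smul, smul_apply, Finsupp.smul_sum, LinearMap.smul_apply]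
  have h1 : ∀ a b f, inner ℂ (Φ a f) (Φ b f) = inner ℂ (e f) (Φ (star a * b) f) := by
    intro a b f
    simp only [he, hΦ, Finsupp.sum, sum_inner, inner_sum, hinner, B.inner_lsmul_left, B.lsmul_mul]
  have h2 : ∀ a f, inner ℂ (Φ a f) (e f) = inner ℂ (e f) (Φ (star a) f) := by
    intro a f
    simp only [he, hΦ, Finsupp.sum, sum_inner, inner_sum, hinner, B.inner_lsmul_left]
  have hbound : ∀ a f, ‖Φ a f‖ ≤ ‖a‖ * ‖e f‖ := by
    intro a f
    -- expand `0 ≤ ‖(‖a‖ + c) e f‖²`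
    obtain ⟨c, hc, hca⟩ := exists_mem_sq_add hA a
    have h3 : (0 : ℝ) ≤ RCLike.re (inner ℂ ((‖a‖ : ℂ) • e f + Φ c f) ((‖a‖ : ℂ) • e f + Φ c f)) :=
      inner_self_nonneg
    have h4 : inner ℂ ((‖a‖ : ℂ) • e f + Φ c f) ((‖a‖ : ℂ) • e f + Φ c f) =
        (‖a‖ : ℂ) ^ 2 * inner ℂ (e f) (e f) +
          inner ℂ (e f) (Φ ((2 * ‖a‖ : ℂ) • c + c * c) f) := by
      simp only [inner_add_left, inner_add_right, inner_smul_left, inner_smul_right, h1, h2, hc,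
        hadd, hsmul, Complex.conj_ofReal]
      ring
    have h5 : inner ℂ (e f) (Φ (-(star a * a)) f) = -inner ℂ (Φ a f) (Φ a f) := by
      rw [h1, ← neg_one_smul ℂ, hsmul, inner_smul_right, neg_one_mul]
    rw [h4, hca, h5, inner_self_eq_norm_sq_to_K, inner_self_eq_norm_sq_to_K] at h3
    have h6 : (0 : ℝ) ≤ ‖a‖ ^ 2 * ‖e f‖ ^ 2 - ‖Φ a f‖ ^ 2 := by
      refine h3.trans_eq ?_
      rw [← Complex.ofReal_re (‖a‖ ^ 2 * ‖e f‖ ^ 2 - ‖Φ a f‖ ^ 2)]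
      push_cast
      rfl
    refine (pow_le_pow_iff_left₀ (by positivity) (by positivity) two_ne_zero).1 ?_
    rw [mul_pow]
    linarith
  have hdense : DenseRange e := by
    have : Dense (LinearMap.range e : Set K) := by
      refine hd.mono (Submodule.span_le.2 ?_)
      rintro _ ⟨x, ξ, rfl⟩
      exact ⟨Finsupp.single x ξ, by simp [he]⟩
    exact this
  let R : A → (K →L[ℂ] K) := fun a => (Φ a).extendOfNorm e
  have hR : ∀ a x ξ, R a (L x ξ) = L (B.lsmul a x) ξ := by
    intro a x ξ
    have h := LinearMap.extendOfNorm_eq (f := Φ a) hdense ⟨_, hbound a⟩ (Finsupp.single x ξ)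
    rw [he, hΦ, Finsupp.sum_single_index (by simp), Finsupp.sum_single_index (by simp)] at h
    exact h
  have hext : ∀ S T : K →L[ℂ] K, (∀ x ξ, S (L x ξ) = T (L x ξ)) → S = T := by
    intro S T h
    refine ContinuousLinearMap.ext_on hd ?_
    rintro _ ⟨x, ξ, rfl⟩
    exact h x ξ
  refine ⟨{ toFun := R, map_smul' := ?_, map_zero' := ?_, map_add' := ?_, map_mul' := ?_,
            map_star' := ?_ }, fun a x => ?_⟩
  · intro c a
    exact hext _ _ fun x ξ => by simp [hR]
  · exact hext _ _ fun x ξ => by simp [hR]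
  · intro a b
    exact hext _ _ fun x ξ => by simp [hR]
  · intro a b
    exact hext _ _ fun x ξ => by simp [hR, B.lsmul_mul]
  · intro a
    refine hext _ _ fun x ξ => ?_
    rw [← sub_eq_zero]
    refine hd.eq_zero_of_inner_left (𝕜 := ℂ) fun v hv => ?_
    induction hv using Submodule.span_induction with
    | mem v hv =>
      obtain ⟨y, η, rfl⟩ := hv
      rw [inner_sub_left, ContinuousLinearMap.star_eq_adjoint,
        ContinuousLinearMap.adjoint_inner_left, hR, hR, hinner, hinner, B.inner_lsmul_left,
        star_star, sub_self]
    | zero => simp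
    | add v w _ _ hv hw =>
      rw [inner_add_right, hv, hw, add_zero]
    | smul c v _ hv =>
      rw [inner_smul_right, hv, mul_zero]
  · ext1 ξ
    exact hR a x ξ

/-- Restriction of a *-representation to its essential subspace, with `j` the orthogonal
projection onto that subspace. -/
theorem exists_nondegenerate_compression {K : Type u} [NormedAddCommGroup K]
    [InnerProductSpace ℂ K] [CompleteSpace K] [SeparableSpace K] (ρ : A →⋆ₙₐ[ℂ] (K →L[ℂ] K)) :
    ∃ (K' : Type u) (_ : NormedAddCommGroup K') (_ : InnerProductSpace ℂ K') (_ : CompleteSpace K')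
      (_ : SeparableSpace K') (ρ' : A →⋆ₙₐ[ℂ] (K' →L[ℂ] K')) (j : K →L[ℂ] K'),
      Dense (Submodule.span ℂ {ζ : K' | ∃ a ξ, ζ = ρ' a ξ} : Set K') ∧
      ∀ a, ContinuousLinearMap.adjoint j ∘L ρ' a ∘L j = ρ a := by
  let S : Submodule ℂ K := Submodule.span ℂ {ζ : K | ∃ a ξ, ζ = ρ a ξ}
  let M : Submodule ℂ K := S.topologicalClosure
  have hM : IsClosed (M : Set K) := S.isClosed_topologicalClosure
  have : CompleteSpace M := hM.completeSpace_coe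
  have : SecondCountableTopology K := UniformSpace.secondCountable_of_separable K
  let j : K →L[ℂ] M := M.orthogonalProjectionOnto
  have hj : ∀ z : K, z ∈ M → (j z : K) = z := fun z hz =>
    Submodule.starProjection_eq_self_iff.2 hz
  have hρM : ∀ a z, ρ a z ∈ M := fun a z =>
    S.le_topologicalClosure (Submodule.subset_span ⟨a, z, rfl⟩)
  have hadj : ∀ x : M, ContinuousLinearMap.adjoint j x = (x : K) := by
    intro x
    refine ext_inner_left ℂ fun z => ?_
    rw [ContinuousLinearMap.adjoint_inner_right]
    have := Submodule.inner_orthogonalProjectionOnto_eq_of_mem_right x z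
    exact this
  have hρj : ∀ a z, ρ a (j z : K) = ρ a z := by
    intro a z
    refine ext_inner_left ℂ fun w => ?_
    have h1 : ∀ z, inner ℂ w (ρ a z) = inner ℂ (ρ (star a) w) z := fun z => by
      rw [map_star, ContinuousLinearMap.star_eq_adjoint, ContinuousLinearMap.adjoint_inner_left]
    rw [h1, h1, ← hadj, ContinuousLinearMap.adjoint_inner_right]
    have h2 : j (ρ (star a) w) = ⟨ρ (star a) w, hρM _ _⟩ := Subtype.ext (hj _ (hρM _ _))
    rw [h2]
    exact Submodule.inner_orthogonalProjectionOnto_eq_of_mem_left ⟨ρ (star a) w, hρM _ _⟩ z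
  let R : A → (M →L[ℂ] M) := fun a => j ∘L ρ a ∘L M.subtypeL
  have hR : ∀ a (z : M), (R a z : K) = ρ a z := fun a z => hj _ (hρM _ _)
  let ρ' : A →⋆ₙₐ[ℂ] (M →L[ℂ] M) :=
    { toFun := R
      map_smul' := fun c a => by ext z; simp [hR]
      map_zero' := by ext z; simp [hR]
      map_add' := fun a b => by ext z; simp [hR]
      map_mul' := fun a b => by ext z; simp [hR]
      map_star' := fun a => by
        ext1 z
        refine ext_inner_left ℂ fun w => ?_
        rw [ContinuousLinearMap.star_eq_adjoint, ContinuousLinearMap.adjoint_inner_right,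
          Submodule.coe_inner, Submodule.coe_inner, hR, hR, map_star,
          ContinuousLinearMap.star_eq_adjoint, ContinuousLinearMap.adjoint_inner_right] }
  refine ⟨M, inferInstance, inferInstance, inferInstance, inferInstance, ρ', j, ?_, fun a => ?_⟩
  · intro z
    have hz : (z : K) ∈ closure (S : Set K) := z.2
    have h1 : j z ∈ closure (j '' (S : Set K)) :=
      image_closure_subset_closure_image j.continuous ⟨_, hz, rfl⟩
    have h2 : j z = z := Subtype.ext (hj _ z.2)
    rw [h2] at h1
    refine closure_mono ?_ h1
    have h3 : S.map j.toLinearMap ≤ Submodule.span ℂ {ζ : M | ∃ a ξ, ζ = ρ' a ξ} := by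
      rw [Submodule.map_span_le]
      rintro _ ⟨a, ξ, rfl⟩
      refine Submodule.subset_span ⟨a, j ξ, Subtype.ext ?_⟩
      exact (hj _ (hρM _ _)).trans ((hρj a ξ).symm.trans (hR a (j ξ)).symm)
    rintro _ ⟨s, hs, rfl⟩
    exact h3 ⟨s, hs, rfl⟩
  · ext1 z
    rw [ContinuousLinearMap.comp_apply, hadj]
    exact (hR a (j z)).trans (hρj a z)

/-- A countably generated Hilbert bimodule is realised by operators into a separable Hilbert space
carrying a nondegenerate representation of `A`. -/
theorem exists_bimodule_realisation [SeparableSpace H] [SeparableSpace A]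
    (hA : IsClosed (A : Set (H →L[ℂ] H))) (B : HilbertBimodule A N) (hB : B.CountablyGenerated) :
    ∃ (K : Type u) (_ : NormedAddCommGroup K) (_ : InnerProductSpace ℂ K) (_ : CompleteSpace K)
      (_ : SeparableSpace K) (ρ : A →⋆ₙₐ[ℂ] (K →L[ℂ] K)) (L : N →L[ℂ] (H →L[ℂ] K)),
      Dense (Submodule.span ℂ {ζ : K | ∃ a ξ, ζ = ρ a ξ} : Set K) ∧
      ∀ a x y, ContinuousLinearMap.adjoint (L y) ∘L ρ a ∘L L x = B.inner y (B.lsmul a x) := by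
  have := B.separableSpace hB
  obtain ⟨K, _, _, _, L, hL, hd⟩ := B.exists_interiorTensor hA
  obtain ⟨ρ, hρ⟩ := exists_inducedRepresentation hA B hL hd
  let L₁ : N →L[ℂ] (H →L[ℂ] K) := L.mkContinuous 1 fun x => by
    rw [norm_creation B hL, one_mul]
  have : SeparableSpace K := by
    have e : {ζ : K | ∃ x ξ, ζ = L x ξ} = Set.range fun p : N × H => L₁ p.1 p.2 := by
      ext ζ; simp [L₁, eq_comm]
    have h1 : IsSeparable {ζ : K | ∃ x ξ, ζ = L x ξ} := by
      rw [e]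
      exact isSeparable_range (by fun_prop)
    have h2 : IsSeparable (Set.univ : Set K) := by
      rw [← hd.closure_eq]
      exact (h1.span (R := ℂ)).closure
    exact isSeparable_univ_iff.1 h2
  obtain ⟨K', _, _, _, _, ρ', j, hd', hj⟩ := exists_nondegenerate_compression ρ
  refine ⟨K', inferInstance, inferInstance, inferInstance, inferInstance, ρ',
    (ContinuousLinearMap.compL ℂ H K K' j) ∘L L₁, hd', fun a x y => ?_⟩
  have h1 : ContinuousLinearMap.adjoint (j ∘L L y) ∘L ρ' a ∘L (j ∘L L x) =
      ContinuousLinearMap.adjoint (L y) ∘L (ContinuousLinearMap.adjoint j ∘L ρ' a ∘L j) ∘L L x := by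
    rw [ContinuousLinearMap.adjoint_comp]
    rfl
  refine Eq.trans h1 ?_
  rw [hj, hρ, hL]

end Tensor

/-! ### Kernel operators composed with a representation -/

section ElementaryTensor

variable {X : Type*} [MeasurableSpace X] {μ : Measure X}
  {E : Type*} [NormedAddCommGroup E] [InnerProductSpace ℂ E]

/-- The function `x ↦ g(x) ζ`, that is, `g ⊗ ζ` under `L²(X) ⊗ E ≅ L²(X, E)`. -/
def l2Tensor (g : Lp ℂ 2 μ) (ζ : E) : Lp E 2 μ :=
  (ContinuousLinearMap.toSpanSingleton ℂ ζ).compLp g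

theorem l2Tensor_coeFn (g : Lp ℂ 2 μ) (ζ : E) : l2Tensor g ζ =ᵐ[μ] fun x => g x • ζ := by
  filter_upwards [ContinuousLinearMap.coeFn_compLp (ContinuousLinearMap.toSpanSingleton ℂ ζ) g]
    with x hx
  rw [l2Tensor, hx, ContinuousLinearMap.toSpanSingleton_apply]

theorem inner_l2Tensor (g g' : Lp ℂ 2 μ) (ζ ζ' : E) :
    inner ℂ (l2Tensor g ζ) (l2Tensor g' ζ') = inner ℂ g g' * inner ℂ ζ ζ' := by
  rw [L2.inner_def, L2.inner_def, ← integral_mul_const]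
  refine integral_congr_ae ?_
  filter_upwards [l2Tensor_coeFn g ζ, l2Tensor_coeFn g' ζ'] with x h1 h2
  rw [h1, h2, inner_smul_left, inner_smul_right, RCLike.inner_apply]
  ring

/-- `g ⊗ ζ` as a continuous linear function of `g`. -/
def l2TensorLeft (ζ : E) : Lp ℂ 2 μ →L[ℂ] Lp E 2 μ :=
  (ContinuousLinearMap.toSpanSingleton ℂ ζ).compLpL 2 μ

/-- `g ⊗ ζ` as a linear function of `ζ`. -/
def l2TensorRight (g : Lp ℂ 2 μ) : E →ₗ[ℂ] Lp E 2 μ where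
  toFun ζ := l2Tensor g ζ
  map_add' ζ ζ' := by
    refine Lp.ext ?_
    filter_upwards [l2Tensor_coeFn g ζ, l2Tensor_coeFn g ζ', l2Tensor_coeFn g (ζ + ζ'),
      Lp.coeFn_add (l2Tensor g ζ) (l2Tensor g ζ')] with x h1 h2 h3 h4
    rw [h3, h4, Pi.add_apply, h1, h2, smul_add]
  map_smul' c ζ := by
    refine Lp.ext ?_
    filter_upwards [l2Tensor_coeFn g ζ, l2Tensor_coeFn g (c • ζ),
      Lp.coeFn_smul c (l2Tensor g ζ)] with x h1 h2 h3
    rw [h2, RingHom.id_apply, h3, Pi.smul_apply, h1, smul_comm]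

theorem norm_sq_sum_l2Tensor {σ : Type*} {b : σ → Lp ℂ 2 μ} (hb : Orthonormal ℂ b)
    (S : Finset σ) (z : S → E) :
    ‖∑ s : S, l2Tensor (b s) (z s)‖ ^ 2 = ∑ s, ‖z s‖ ^ 2 := by
  classical
  have h : inner ℂ (∑ s : S, l2Tensor (b s) (z s)) (∑ s : S, l2Tensor (b s) (z s)) =
      ∑ s, inner ℂ (z s) (z s) := by
    simp only [sum_inner, inner_sum, inner_l2Tensor, orthonormal_iff_ite.1 hb, ite_mul, one_mul,
      zero_mul, SetLike.coe_eq_coe]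
    simp
  simp only [inner_self_eq_norm_sq_to_K] at h
  exact_mod_cast h

/-- Sums of tensors `b s ⊗ ζ` over an orthonormal basis `b` of `L²(X)` are dense in `L²(X, E)`. -/
theorem denseRange_sum_l2Tensor {σ : Type*} (b : HilbertBasis σ ℂ (Lp ℂ 2 μ)) :
    DenseRange (Finsupp.lsum ℂ fun s => l2TensorRight (E := E) (b s)) := by
  set e : (σ →₀ E) →ₗ[ℂ] Lp E 2 μ := Finsupp.lsum ℂ fun s => l2TensorRight (E := E) (b s)
  set M := (LinearMap.range e).topologicalClosure
  have h1 : ∀ s ζ, l2Tensor (b s) ζ ∈ M := fun s ζ =>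
    Submodule.le_topologicalClosure _ ⟨Finsupp.single s ζ, Finsupp.lsum_single ..⟩
  have h2 : ∀ g ζ, l2Tensor g ζ ∈ M := by
    intro g ζ
    have h3 : (Submodule.span ℂ (Set.range b)).topologicalClosure ≤
        M.comap (l2TensorLeft ζ).toLinearMap := by
      refine Submodule.topologicalClosure_minimal _ (Submodule.span_le.2 ?_) ?_
      · rintro _ ⟨s, rfl⟩
        exact h1 s ζ
      · exact (Submodule.isClosed_topologicalClosure _).preimage (l2TensorLeft ζ).continuous
    rw [b.dense_span] at h3
    exact h3 (x := g) trivial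
  have h4 : ∀ f : Lp E 2 μ, f ∈ M := by
    intro f
    refine Lp.induction (by norm_num) (fun f : Lp E 2 μ => f ∈ M) ?_ ?_ ?_ f
    · intro c s hs hμs
      rw [Lp.simpleFunc.coe_indicatorConst]
      convert h2 (indicatorConstLp 2 hs hμs.ne (1 : ℂ)) c using 1
      refine Lp.ext ?_
      filter_upwards [l2Tensor_coeFn (indicatorConstLp 2 hs hμs.ne (1 : ℂ)) c,
        indicatorConstLp_coeFn (p := 2) (hs := hs) (hμs := hμs.ne) (c := c),
        indicatorConstLp_coeFn (p := 2) (hs := hs) (hμs := hμs.ne) (c := (1 : ℂ))] with x h1 h2 h3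
      rw [h1, h2, h3]
      by_cases hx : x ∈ s <;> simp [hx]
    · intro f g hf hg _ h1 h2
      exact add_mem h1 h2
    · exact Submodule.isClosed_topologicalClosure _
  intro f
  exact h4 f

end ElementaryTensor

section KernelCoefficients

variable {X Y : Type*} [MeasurableSpace X] [MeasurableSpace Y]
  {μ : Measure X} {ν : Measure Y} [SFinite μ] [SFinite ν]
  {E : Type*} [NormedAddCommGroup E] [InnerProductSpace ℂ E] [CompleteSpace E]
  {A : NonUnitalStarSubalgebra ℂ (E →L[ℂ] E)}

/-- The coefficient `∫ conj (g(y)) f(x) k(y, x)` of a kernel `k` with values in `A`. -/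
def kernelCoeff (g : Lp ℂ 2 ν) (f : Lp ℂ 2 μ) (k : Lp A 2 (ν.prod μ)) : A :=
  ∫ p, (star (g p.1) * f p.2) • k p ∂(ν.prod μ)

theorem memLp_star_mul (g : Lp ℂ 2 ν) (f : Lp ℂ 2 μ) :
    MemLp (fun p : Y × X => star (g p.1) * f p.2) 2 (ν.prod μ) := by
  have hm : AEStronglyMeasurable (fun p : Y × X => star (g p.1) * f p.2) (ν.prod μ) :=
    (continuous_star.comp_aestronglyMeasurable (Lp.aestronglyMeasurable g).comp_fst).mul
      (Lp.aestronglyMeasurable f).comp_snd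
  rw [memLp_two_iff_integrable_sq_norm hm]
  have h1 := (memLp_two_iff_integrable_sq_norm (Lp.aestronglyMeasurable g)).1 (Lp.memLp g)
  have h2 := (memLp_two_iff_integrable_sq_norm (Lp.aestronglyMeasurable f)).1 (Lp.memLp f)
  refine (h1.mul_prod h2).congr (Filter.Eventually.of_forall fun p => ?_)
  simp only [norm_mul, norm_star, mul_pow]

theorem integrable_kernelCoeff (g : Lp ℂ 2 ν) (f : Lp ℂ 2 μ) (k : Lp A 2 (ν.prod μ)) :
    Integrable (fun p : Y × X => (star (g p.1) * f p.2) • k p) (ν.prod μ) := by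
  rw [← memLp_one_iff_integrable]
  exact (Lp.memLp k).smul (memLp_star_mul g f)

/-- Between elementary tensors, `T_k` compresses to an element of `A`. -/
theorem inner_kernelOp_l2Tensor (hA : IsClosed (A : Set (E →L[ℂ] E))) (g : Lp ℂ 2 ν)
    (f : Lp ℂ 2 μ) (k : Lp A 2 (ν.prod μ)) (θ ζ : E) :
    inner ℂ (l2Tensor g θ) (kernelOp A k (l2Tensor f ζ)) =
      inner ℂ θ ((kernelCoeff g f k : E →L[ℂ] E) ζ) := by
  have : CompleteSpace A := hA.completeSpace_coe
  let ℓ : A →L[ℂ] ℂ := innerSL ℂ θ ∘L ContinuousLinearMap.apply ℂ E ζ ∘L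
    (LinearMap.mkContinuous (NonUnitalSubalgebraClass.subtype A : A →ₗ[ℂ] (E →L[ℂ] E)) 1
      fun a => by rw [one_mul]; rfl)
  have hℓ : ∀ a : A, ℓ a = inner ℂ θ ((a : E →L[ℂ] E) ζ) := fun a => rfl
  have hint := ℓ.integrable_comp (integrable_kernelCoeff g f k)
  rw [← hℓ, kernelCoeff, ← ℓ.integral_comp_comm (integrable_kernelCoeff g f k),
    integral_prod _ hint, L2.inner_def]
  refine integral_congr_ae ?_
  filter_upwards [l2Tensor_coeFn g θ, kernelOp_apply_ae A k (l2Tensor f ζ),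
    ae_integrable_kernel (memLp_coe k) (Lp.memLp (l2Tensor f ζ))] with y h1 h2 h3
  rw [h2, ← integral_inner h3, h1]
  refine integral_congr_ae ?_
  filter_upwards [l2Tensor_coeFn f ζ] with x hx
  rw [hx, map_smul, hℓ, SetLike.val_smul, smul_apply, inner_smul_left, inner_smul_right,
    inner_smul_right, mul_assoc]
  rfl

theorem sum_inner_kernelOp_l2Tensor (hA : IsClosed (A : Set (E →L[ℂ] E))) {n : ℕ}
    (k : Fin n → Fin n → Lp A 2 (ν.prod μ)) {σ τ : Type*} [Fintype σ] [Fintype τ]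
    (g : σ → Lp ℂ 2 ν) (f : τ → Lp ℂ 2 μ) (θ : Fin n × σ → E) (ζ : Fin n × τ → E) :
    ∑ i, ∑ j, inner ℂ (∑ s, l2Tensor (g s) (θ (i, s)))
        (kernelOp A (k i j) (∑ t, l2Tensor (f t) (ζ (j, t)))) =
      ∑ p, ∑ q, inner ℂ (θ p) ((kernelCoeff (g p.2) (f q.2) (k p.1 q.1) : E →L[ℂ] E) (ζ q)) := by
  have h : ∀ i j, inner ℂ (∑ s, l2Tensor (g s) (θ (i, s)))
      (kernelOp A (k i j) (∑ t, l2Tensor (f t) (ζ (j, t)))) =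
      ∑ s, ∑ t, inner ℂ (θ (i, s)) ((kernelCoeff (g s) (f t) (k i j) : E →L[ℂ] E) (ζ (j, t))) := by
    intro i j
    rw [map_sum, sum_inner]
    simp only [inner_sum, inner_kernelOp_l2Tensor hA]
  simp only [h, Fintype.sum_prod_type]
  exact Finset.sum_congr rfl fun i _ => Finset.sum_comm

/-- Postcomposition of a kernel with a *-representation, as a kernel with values in all of
`B(K)`. -/
def repKernel {H K : Type*} [NormedAddCommGroup H] [InnerProductSpace ℂ H] [CompleteSpace H]
    [NormedAddCommGroup K] [InnerProductSpace ℂ K] [CompleteSpace K]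
    {A : NonUnitalStarSubalgebra ℂ (H →L[ℂ] H)} (hA : IsClosed (A : Set (H →L[ℂ] H)))
    (ρ : A →⋆ₙₐ[ℂ] (K →L[ℂ] K)) : A →L[ℂ] (⊤ : NonUnitalStarSubalgebra ℂ (K →L[ℂ] K)) :=
  LinearMap.mkContinuous
    { toFun := fun a => ⟨ρ a, trivial⟩
      map_add' := fun a b => Subtype.ext (map_add ρ a b)
      map_smul' := fun c a => Subtype.ext (map_smul ρ c a) } 1 fun a => by
    have := hA
    rw [one_mul]
    exact NonUnitalStarAlgHom.norm_apply_le ρ a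

section Amplified

variable {H : Type*} [NormedAddCommGroup H] [InnerProductSpace ℂ H] [CompleteSpace H]
  {K : Type*} [NormedAddCommGroup K] [InnerProductSpace ℂ K] [CompleteSpace K]
  {A : NonUnitalStarSubalgebra ℂ (H →L[ℂ] H)}

theorem coe_repKernel (hA : IsClosed (A : Set (H →L[ℂ] H))) (ρ : A →⋆ₙₐ[ℂ] (K →L[ℂ] K)) (a : A) :
    (repKernel hA ρ a : K →L[ℂ] K) = ρ a := rfl

theorem kernelCoeff_repKernel (hA : IsClosed (A : Set (H →L[ℂ] H))) (ρ : A →⋆ₙₐ[ℂ] (K →L[ℂ] K))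
    (g : Lp ℂ 2 ν) (f : Lp ℂ 2 μ) (k : Lp A 2 (ν.prod μ)) :
    kernelCoeff g f ((repKernel hA ρ).compLp k) = repKernel hA ρ (kernelCoeff g f k) := by
  have : CompleteSpace A := hA.completeSpace_coe
  have hT : IsClosed ((⊤ : NonUnitalStarSubalgebra ℂ (K →L[ℂ] K)) : Set (K →L[ℂ] K)) :=
    isClosed_univ
  have : CompleteSpace (⊤ : NonUnitalStarSubalgebra ℂ (K →L[ℂ] K)) := hT.completeSpace_coe
  rw [kernelCoeff, kernelCoeff,
    ← (repKernel hA ρ).integral_comp_comm (integrable_kernelCoeff g f k)]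
  refine integral_congr_ae ?_
  filter_upwards [ContinuousLinearMap.coeFn_compLp (repKernel hA ρ) k] with p hp
  rw [hp, map_smul]

/-- `T_k ↦ T_{ρ ∘ k}` is completely contractive. On finite sums of elementary tensors over
orthonormal systems both sides are compressions to matrices over `A` and `ρ(A)`, where complete
contractivity of `ρ` applies. -/
theorem norm_sum_inner_kernelOp_repKernel_le (hA : IsClosed (A : Set (H →L[ℂ] H)))
    (ρ : A →⋆ₙₐ[ℂ] (K →L[ℂ] K)) {n : ℕ} (k : Fin n → Fin n → Lp A 2 (ν.prod μ))
    (η : Fin n → Lp K 2 ν) (ξ : Fin n → Lp K 2 μ) :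
    ‖∑ i, ∑ j, inner ℂ (η i) (kernelOp ⊤ ((repKernel hA ρ).compLp (k i j)) (ξ j))‖ ≤
      ‖ofEntries fun i j => kernelOp A (k i j)‖ * √(∑ i, ‖η i‖ ^ 2) * √(∑ j, ‖ξ j‖ ^ 2) := by
  classical
  obtain ⟨σ, b, hb⟩ := exists_hilbertBasis ℂ (Lp ℂ 2 ν)
  obtain ⟨τ, c, hc⟩ := exists_hilbertBasis ℂ (Lp ℂ 2 μ)
  have hT : IsClosed ((⊤ : NonUnitalStarSubalgebra ℂ (K →L[ℂ] K)) : Set (K →L[ℂ] K)) :=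
    isClosed_univ
  have hdense := (DenseRange.piMap fun _ : Fin n => denseRange_sum_l2Tensor (E := K) b).prodMap
    (DenseRange.piMap fun _ : Fin n => denseRange_sum_l2Tensor (E := K) c)
  refine isClosed_property (p := fun q : (Fin n → Lp K 2 ν) × (Fin n → Lp K 2 μ) =>
    ‖∑ i, ∑ j, inner ℂ (q.1 i) (kernelOp ⊤ ((repKernel hA ρ).compLp (k i j)) (q.2 j))‖ ≤
      ‖ofEntries fun i j => kernelOp A (k i j)‖ * √(∑ i, ‖q.1 i‖ ^ 2) * √(∑ j, ‖q.2 j‖ ^ 2))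
    hdense ?_ ?_ (η, ξ)
  · exact isClosed_le (by fun_prop) (by fun_prop)
  rintro ⟨z, w⟩
  let S : Finset σ := Finset.univ.biUnion fun i => (z i).support
  let T : Finset τ := Finset.univ.biUnion fun j => (w j).support
  have hz : ∀ i, (Finsupp.lsum ℂ fun s => l2TensorRight (E := K) (b s)) (z i) =
      ∑ s : S, l2Tensor (b s) (z i s) := by
    intro i
    rw [Finsupp.lsum_apply, Finsupp.sum_of_support_subset (s := S), ← Finset.sum_coe_sort]
    · rfl
    · exact Finset.subset_biUnion_of_mem (fun i => (z i).support) (Finset.mem_univ i)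
    · intro s _
      exact map_zero _
  have hw : ∀ j, (Finsupp.lsum ℂ fun t => l2TensorRight (E := K) (c t)) (w j) =
      ∑ t : T, l2Tensor (c t) (w j t) := by
    intro j
    rw [Finsupp.lsum_apply, Finsupp.sum_of_support_subset (s := T), ← Finset.sum_coe_sort]
    · rfl
    · exact Finset.subset_biUnion_of_mem (fun j => (w j).support) (Finset.mem_univ j)
    · intro t _
      exact map_zero _
  simp only [Prod.map_apply, Pi.map_apply, hz, hw]
  have key := norm_sum_inner_map_le hA ρ
    (fun (p : Fin n × S) (q : Fin n × T) => kernelCoeff (b p.2) (c q.2) (k p.1 q.1))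
    (norm_nonneg (ofEntries fun i j => kernelOp A (k i j))) ?_
    (fun p => z p.1 p.2) (fun q => w q.1 q.2)
  · have e := sum_inner_kernelOp_l2Tensor hT (fun i j => (repKernel hA ρ).compLp (k i j))
      (fun s : S => b s) (fun t : T => c t) (fun p => z p.1 p.2) (fun q => w q.1 q.2)
    simp only at e
    rw [e]
    simp only [kernelCoeff_repKernel, coe_repKernel, norm_sq_sum_l2Tensor b.orthonormal,
      norm_sq_sum_l2Tensor c.orthonormal]
    simpa only [Fintype.sum_prod_type] using key
  · intro θ ζ
    rw [← sum_inner_kernelOp_l2Tensor hA k (fun s : S => b s) (fun t : T => c t) θ ζ]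
    refine (norm_sum_inner_le _ _ _).trans_eq ?_
    simp only [norm_sq_sum_l2Tensor b.orthonormal S fun s => θ (_, s),
      norm_sq_sum_l2Tensor c.orthonormal T fun t => ζ (_, t), Fintype.sum_prod_type]

end Amplified

end KernelCoefficients

/-! ### Bimodule representations give Schur multipliers -/

section Block

variable {E F : Type*} [NormedAddCommGroup E] [InnerProductSpace ℂ E]
  [NormedAddCommGroup F] [InnerProductSpace ℂ F] {ι : Type*} [Fintype ι] [DecidableEq ι]

/-- An instance of `norm_nonneg`; between `L²` spaces the general lemma is expensive to unify. -/
theorem norm_ofEntries_nonneg (a : ι → ι → (E →L[ℂ] F)) : 0 ≤ ‖ofEntries a‖ :=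
  norm_nonneg (ofEntries a)

theorem norm_ofEntries_eq_zero_iff {a : ι → ι → (E →L[ℂ] F)} :
    ‖ofEntries a‖ = 0 ↔ ∀ i j, a i j = 0 := by
  refine (norm_eq_zero (a := ofEntries a)).trans ⟨fun h i j => ?_, fun h => ext_entry fun i j => ?_⟩
  · rw [← entry_ofEntries a i j, h, entry_zero]
  · rw [entry_ofEntries, h, entry_zero]

end Block

section SchurOfRepresentation

variable {H : Type u} [NormedAddCommGroup H] [InnerProductSpace ℂ H] [CompleteSpace H]
  {K : Type*} [NormedAddCommGroup K] [InnerProductSpace ℂ K] [CompleteSpace K]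
  {A : NonUnitalStarSubalgebra ℂ (H →L[ℂ] H)} [SeparableSpace A]
  {X Y : Type*} [MeasurableSpace X] [MeasurableSpace Y]
  {μ : Measure X} {ν : Measure Y} [SFinite μ] [SFinite ν] {φ : X → Y → CBMap A}

/-- Pointwise application of a bounded operator-valued function preserves `L²`. -/
theorem memLp_pointwise {V : X → (H →L[ℂ] K)} (hV : AEStronglyMeasurable V μ) {M : ℝ}
    (hM : ∀ x, ‖V x‖ ≤ M) (ξ : Lp H 2 μ) : MemLp (fun x => V x (ξ x)) 2 μ := by
  refine MemLp.of_le_mul (c := M) (Lp.memLp ξ) ?_ (Filter.Eventually.of_forall fun x =>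
    (V x).le_of_opNorm_le (hM x) _)
  exact (ContinuousLinearMap.id ℂ (H →L[ℂ] K)).aestronglyMeasurable_comp₂ hV
    (Lp.aestronglyMeasurable ξ)

theorem norm_pointwise_le {V : X → (H →L[ℂ] K)} (hV : AEStronglyMeasurable V μ) {M : ℝ}
    (hM : ∀ x, ‖V x‖ ≤ M) (ξ : Lp H 2 μ) :
    ‖(memLp_pointwise hV hM ξ).toLp _‖ ≤ M * ‖ξ‖ := by
  refine Lp.norm_le_mul_norm_of_ae_le_mul ?_
  filter_upwards [(memLp_pointwise hV hM ξ).coeFn_toLp] with x hx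
  rw [hx]
  exact (V x).le_of_opNorm_le (hM x) _

/-- Separability of `A` makes the exceptional null set in a representation of `φ` independent of
the algebra element. -/
theorem ae_forall_representation (hA : IsClosed (A : Set (H →L[ℂ] H))) (hb : IsBoundedFamily φ)
    (ρ : A →⋆ₙₐ[ℂ] (K →L[ℂ] K)) {V : X → (H →L[ℂ] K)} {W : Y → (H →L[ℂ] K)}
    (hrep : ∀ a : A, ∀ᵐ p ∂(μ.prod ν), (φ p.1 p.2 a : H →L[ℂ] H) =
      (ContinuousLinearMap.adjoint (W p.2)) ∘L (ρ a) ∘L (V p.1)) :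
    ∀ᵐ p ∂(ν.prod μ), ∀ a : A, (φ p.2 p.1 a : H →L[ℂ] H) =
      (ContinuousLinearMap.adjoint (W p.1)) ∘L (ρ a) ∘L (V p.2) := by
  obtain ⟨M, hM⟩ := hb
  have h1 : ∀ᵐ p ∂(μ.prod ν), ∀ n, (φ p.1 p.2 (denseSeq A n) : H →L[ℂ] H) =
      (ContinuousLinearMap.adjoint (W p.2)) ∘L (ρ (denseSeq A n)) ∘L (V p.1) :=
    ae_all_iff.2 fun n => hrep _
  filter_upwards [(Measure.measurePreserving_swap (μ := ν)
    (ν := μ)).quasiMeasurePreserving.ae h1] with p hp a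
  have hρ : Continuous ρ := continuous_subtype_val.comp (repKernel hA ρ).continuous
  have hφ : Continuous fun a : A => φ p.2 p.1 a :=
    AddMonoidHomClass.continuous_of_bound (φ p.2 p.1).toLinearMap M fun a => hM _ _ _
  refine isClosed_property (p := fun a : A => (φ p.2 p.1 a : H →L[ℂ] H) =
    (ContinuousLinearMap.adjoint (W p.1)) ∘L (ρ a) ∘L (V p.2)) (denseRange_denseSeq A)
    (isClosed_eq ?_ ?_) hp a
  · exact continuous_subtype_val.comp hφ
  · fun_prop

/-- The identity `T_{φ·k} = W* T_{ρ∘k} V`, with `V` and `W` acting pointwise. -/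
theorem inner_kernelOp_schurAction (hA : IsClosed (A : Set (H →L[ℂ] H))) (hb : IsBoundedFamily φ)
    (hm : PointwiseMeasurable μ ν φ)
    (ρ : A →⋆ₙₐ[ℂ] (K →L[ℂ] K)) {V : X → (H →L[ℂ] K)} {W : Y → (H →L[ℂ] K)}
    (hV : AEStronglyMeasurable V μ) (hW : AEStronglyMeasurable W ν) {M₁ M₂ : ℝ}
    (hM₁ : ∀ x, ‖V x‖ ≤ M₁) (hM₂ : ∀ y, ‖W y‖ ≤ M₂)
    (hrep : ∀ a : A, ∀ᵐ p ∂(μ.prod ν), (φ p.1 p.2 a : H →L[ℂ] H) =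
      (ContinuousLinearMap.adjoint (W p.2)) ∘L (ρ a) ∘L (V p.1))
    (k : Lp A 2 (ν.prod μ)) (η : Lp H 2 ν) (ξ : Lp H 2 μ) :
    inner ℂ η (kernelOp A (schurAction hb hm k) ξ) =
      inner ℂ ((memLp_pointwise hW hM₂ η).toLp _)
        (kernelOp ⊤ ((repKernel hA ρ).compLp k) ((memLp_pointwise hV hM₁ ξ).toLp _)) := by
  set Vξ := (memLp_pointwise hV hM₁ ξ).toLp _
  rw [L2.inner_def, L2.inner_def]
  refine integral_congr_ae ?_
  have h1 : ∀ᵐ p ∂(ν.prod μ), (schurAction hb hm k p : H →L[ℂ] H) =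
      (ContinuousLinearMap.adjoint (W p.1)) ∘L
        (((repKernel hA ρ).compLp k p : _) : K →L[ℂ] K) ∘L (V p.2) := by
    filter_upwards [ae_forall_representation hA hb ρ hrep,
      (memLp_schurAction hb hm k).coeFn_toLp,
      ContinuousLinearMap.coeFn_compLp (repKernel hA ρ) k] with p h1 h2 h3
    rw [schurAction, h2, h1, h3, coe_repKernel]
  filter_upwards [Measure.ae_ae_of_ae_prod h1, kernelOp_apply_ae A (schurAction hb hm k) ξ,
    kernelOp_apply_ae ⊤ ((repKernel hA ρ).compLp k) Vξ,
    (memLp_pointwise hW hM₂ η).coeFn_toLp,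
    ae_integrable_kernel (memLp_coe ((repKernel hA ρ).compLp k)) (Lp.memLp Vξ)]
    with y h2 h3 h4 h5 h6
  rw [h3, h4, h5, ← ContinuousLinearMap.adjoint_inner_right,
    ← ContinuousLinearMap.integral_comp_comm _ h6]
  congr 1
  refine integral_congr_ae ?_
  filter_upwards [h2, (memLp_pointwise hV hM₁ ξ).coeFn_toLp] with x hx hx2
  rw [hx, hx2]
  rfl

theorem norm_schurAction_le (hA : IsClosed (A : Set (H →L[ℂ] H))) (hb : IsBoundedFamily φ)
    (hm : PointwiseMeasurable μ ν φ)
    (ρ : A →⋆ₙₐ[ℂ] (K →L[ℂ] K)) {V : X → (H →L[ℂ] K)} {W : Y → (H →L[ℂ] K)}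
    (hV : AEStronglyMeasurable V μ) (hW : AEStronglyMeasurable W ν) {M₁ M₂ : ℝ}
    (hM₁0 : 0 ≤ M₁) (hM₂0 : 0 ≤ M₂)
    (hM₁ : ∀ x, ‖V x‖ ≤ M₁) (hM₂ : ∀ y, ‖W y‖ ≤ M₂)
    (hrep : ∀ a : A, ∀ᵐ p ∂(μ.prod ν), (φ p.1 p.2 a : H →L[ℂ] H) =
      (ContinuousLinearMap.adjoint (W p.2)) ∘L (ρ a) ∘L (V p.1))
    {n : ℕ} (k : Fin n → Fin n → Lp A 2 (ν.prod μ)) :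
    ‖ofEntries fun i j => kernelOp A (schurAction hb hm (k i j))‖ ≤
      M₁ * M₂ * ‖ofEntries fun i j => kernelOp A (k i j)‖ := by
  have hsqrt : ∀ {ι : Type} [Fintype ι] {M : ℝ} (f g : ι → ℝ), 0 ≤ M → (∀ i, 0 ≤ f i) →
      (∀ i, f i ≤ M * g i) → √(∑ i, f i ^ 2) ≤ M * √(∑ i, g i ^ 2) := by
    intro ι _ M f g hM hf h
    rw [← Real.sqrt_sq hM, ← Real.sqrt_mul (sq_nonneg M), Finset.mul_sum]
    refine Real.sqrt_le_sqrt (Finset.sum_le_sum fun i _ => ?_)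
    rw [← mul_pow]
    exact pow_le_pow_left₀ (hf i) (h i) 2
  refine norm_ofEntries_le _ (by positivity) fun η ξ => ?_
  simp only [inner_kernelOp_schurAction hA hb hm ρ hV hW hM₁ hM₂ hrep]
  refine (norm_sum_inner_kernelOp_repKernel_le hA ρ k _ _).trans ?_
  have h1 := hsqrt (fun i => ‖(memLp_pointwise hW hM₂ (η i)).toLp _‖) (fun i => ‖η i‖) hM₂0
    (fun i => norm_nonneg _) (fun i => norm_pointwise_le hW hM₂ (η i))
  have h2 := hsqrt (fun j => ‖(memLp_pointwise hV hM₁ (ξ j)).toLp _‖) (fun j => ‖ξ j‖) hM₁0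
    (fun i => norm_nonneg _) (fun j => norm_pointwise_le hV hM₁ (ξ j))
  refine (mul_le_mul (mul_le_mul_of_nonneg_left h1 (norm_ofEntries_nonneg _)) h2 (Real.sqrt_nonneg _)
    (mul_nonneg (norm_ofEntries_nonneg _) (mul_nonneg hM₂0 (Real.sqrt_nonneg _)))).trans_eq ?_
  ring

theorem schurAction_add (hb : IsBoundedFamily φ) (hm : PointwiseMeasurable μ ν φ)
    (k l : Lp A 2 (ν.prod μ)) :
    schurAction hb hm (k + l) = schurAction hb hm k + schurAction hb hm l := by
  rw [schurAction, schurAction, schurAction, ← MemLp.toLp_add]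
  refine MemLp.toLp_congr _ _ ?_
  filter_upwards [Lp.coeFn_add k l] with p hp
  rw [hp, Pi.add_apply, Pi.add_apply, map_add]

theorem schurAction_smul (hb : IsBoundedFamily φ) (hm : PointwiseMeasurable μ ν φ)
    (c : ℂ) (k : Lp A 2 (ν.prod μ)) :
    schurAction hb hm (c • k) = c • schurAction hb hm k := by
  refine Lp.ext ?_
  filter_upwards [Lp.coeFn_smul c k, Lp.coeFn_smul c (schurAction hb hm k),
    (memLp_schurAction hb hm k).coeFn_toLp, (memLp_schurAction hb hm (c • k)).coeFn_toLp]
    with p h1 h2 h3 h4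
  have e1 : φ p.2 p.1 ((c • k) p) = c • φ p.2 p.1 (k p) :=
    (congrArg (φ p.2 p.1) h1).trans (map_smul (φ p.2 p.1).toLinearMap c (k p))
  have e2 : (c • schurAction hb hm k) p = c • φ p.2 p.1 (k p) :=
    h2.trans (congrArg (fun a : A => c • a) h3)
  exact h4.trans (e1.trans e2.symm)

theorem exists_linearMap_range {R M N P : Type*} [Ring R] [AddCommGroup M] [AddCommGroup N]
    [AddCommGroup P] [Module R M] [Module R N] [Module R P] (f : M →ₗ[R] N) (g : M →ₗ[R] P)
    (h : LinearMap.ker f ≤ LinearMap.ker g) :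
    ∃ S : LinearMap.range f →ₗ[R] P, ∀ m, S ⟨f m, m, rfl⟩ = g m := by
  refine ⟨(LinearMap.ker f).liftQ g h ∘ₗ f.quotKerEquivRange.symm.toLinearMap, fun m => ?_⟩
  have : (⟨f m, m, rfl⟩ : LinearMap.range f) = f.quotKerEquivRange (Submodule.Quotient.mk m) := rfl
  rw [this, LinearMap.comp_apply, LinearEquiv.coe_coe, LinearEquiv.symm_apply_apply]
  rfl

/-- The norm estimate for `1 × 1` matrices also shows that `T_k ↦ T_{φ·k}` is well defined. -/
theorem isSchurMultiplier_of_representation (hA : IsClosed (A : Set (H →L[ℂ] H)))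
    (hb : IsBoundedFamily φ) (hm : PointwiseMeasurable μ ν φ)
    (ρ : A →⋆ₙₐ[ℂ] (K →L[ℂ] K)) {V : X → (H →L[ℂ] K)} {W : Y → (H →L[ℂ] K)}
    (hV : AEStronglyMeasurable V μ) (hW : AEStronglyMeasurable W ν)
    (hVb : ∃ M, ∀ x, ‖V x‖ ≤ M) (hWb : ∃ M, ∀ y, ‖W y‖ ≤ M)
    (hrep : ∀ a : A, ∀ᵐ p ∂(μ.prod ν), (φ p.1 p.2 a : H →L[ℂ] H) =
      (ContinuousLinearMap.adjoint (W p.2)) ∘L (ρ a) ∘L (V p.1)) :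
    IsSchurMultiplier μ ν φ := by
  obtain ⟨M₁, hM₁⟩ := hVb
  obtain ⟨M₂, hM₂⟩ := hWb
  have key : ∀ {n : ℕ} (k : Fin n → Fin n → Lp A 2 (ν.prod μ)),
      ‖ofEntries fun i j => kernelOp A (schurAction hb hm (k i j))‖ ≤
        |M₁| * |M₂| * ‖ofEntries fun i j => kernelOp A (k i j)‖ := fun k =>
    norm_schurAction_le hA hb hm ρ hV hW (abs_nonneg _) (abs_nonneg _)
      (fun x => (hM₁ x).trans (le_abs_self _)) (fun y => (hM₂ y).trans (le_abs_self _)) hrep k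
  let f : Lp A 2 (ν.prod μ) →ₗ[ℂ] S₂ μ ν A := (kernelOpₗ μ ν A).rangeRestrict
  let g : Lp A 2 (ν.prod μ) →ₗ[ℂ] S₂ μ ν A :=
    f ∘ₗ { toFun := schurAction hb hm
           map_add' := schurAction_add hb hm
           map_smul' := schurAction_smul hb hm }
  have hfg : LinearMap.ker (kernelOpₗ μ ν A) ≤ LinearMap.ker g := by
    intro k hk
    have hk' : kernelOp A k = 0 := hk
    have h := key (n := 1) fun _ _ => k
    rw [norm_ofEntries_eq_zero_iff.2 fun _ _ => hk', mul_zero] at h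
    exact Subtype.ext (norm_ofEntries_eq_zero_iff.1 (le_antisymm h (norm_ofEntries_nonneg _)) 0 0)
  obtain ⟨S, hS⟩ := exists_linearMap_range (kernelOpₗ μ ν A) g hfg
  refine ⟨hb, hm, S, fun k => (hS k).trans rfl, |M₁| * |M₂|, fun n T => ?_⟩
  choose k hk using fun i j => (T i j).2
  have e1 : T = fun i j => ⟨kernelOp A (k i j), k i j, rfl⟩ := by
    funext i j
    exact Subtype.ext (hk i j).symm
  rw [opMatrix_eq_ofEntries, opMatrix_eq_ofEntries, e1]
  refine Eq.trans_le ?_ (key k)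
  congr 2
  funext i j
  exact congrArg Subtype.val (hS (k i j))

end SchurOfRepresentation

section OfBimodule

variable {H : Type u} [NormedAddCommGroup H] [InnerProductSpace ℂ H] [CompleteSpace H]
  [SeparableSpace H] {A : NonUnitalStarSubalgebra ℂ (H →L[ℂ] H)} [SeparableSpace A]
  {X Y : Type*} [MeasurableSpace X] [MeasurableSpace Y]
  {μ : Measure X} {ν : Measure Y} [SFinite μ] [SFinite ν] {φ : X → Y → CBMap A}

theorem WeaklyMeasurable.continuousLinearMap_comp {Ω E F : Type*} [MeasurableSpace Ω]
    [NormedAddCommGroup E] [NormedSpace ℂ E] [NormedAddCommGroup F] [NormedSpace ℂ F]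
    {m : Measure Ω} {f : Ω → E} (hf : WeaklyMeasurable f m) (L : E →L[ℂ] F) :
    WeaklyMeasurable (fun ω => L (f ω)) m := fun ℓ => hf (ℓ ∘L L)

/-- With `L x` the creation operator of `x` into the interior tensor product, `V = L ∘ v` and
`W = L ∘ w` represent `φ`. -/
theorem schur_and_representation_of_bimodule (hA : IsClosed (A : Set (H →L[ℂ] H)))
    (hb : IsBoundedFamily φ) (hm : PointwiseMeasurable μ ν φ)
    (h : HasBimoduleRepresentation μ ν φ) :
    IsSchurMultiplier μ ν φ ∧ HasWeaklyMeasurableRepresentation μ ν φ := by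
  obtain ⟨N, _, _, _, B, v, w, hB, ⟨M₁, hM₁⟩, ⟨M₂, hM₂⟩, hv, hw, hrep⟩ := h
  have := B.separableSpace hB
  obtain ⟨K, _, _, _, _, ρ, L, hd, hL⟩ := exists_bimodule_realisation hA B hB
  have hrep' : ∀ a : A, ∀ᵐ p ∂(μ.prod ν), (φ p.1 p.2 a : H →L[ℂ] H) =
      (ContinuousLinearMap.adjoint (L (w p.2))) ∘L (ρ a) ∘L (L (v p.1)) := by
    intro a
    filter_upwards [hrep a] with p hp
    rw [hp, hL]
  have hVb : ∃ M, ∀ x, ‖L (v x)‖ ≤ M :=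
    ⟨‖L‖ * M₁, fun x => (L.le_opNorm _).trans (by gcongr; exact hM₁ x)⟩
  have hWb : ∃ M, ∀ y, ‖L (w y)‖ ≤ M :=
    ⟨‖L‖ * M₂, fun y => (L.le_opNorm _).trans (by gcongr; exact hM₂ y)⟩
  refine ⟨isSchurMultiplier_of_representation hA hb hm ρ
    (L.continuous.comp_aestronglyMeasurable hv.aestronglyMeasurable)
    (L.continuous.comp_aestronglyMeasurable hw.aestronglyMeasurable) hVb hWb hrep', ?_⟩
  exact ⟨K, inferInstance, inferInstance, inferInstance, inferInstance, ρ, fun x => L (v x),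
    fun y => L (w y), hd, hVb, hWb, hv.continuousLinearMap_comp L, hw.continuousLinearMap_comp L,
    hrep'⟩

end OfBimodule

/-! ### Finite-dimensional algebras in standard form -/

section FiniteDimensional

variable {H : Type u} [NormedAddCommGroup H] [InnerProductSpace ℂ H] [CompleteSpace H]

/-- A finite family of vectors whose span is invariant under `A` and on which `A` acts faithfully;
`expand` says that the vectors behave like an orthonormal basis of the invariant subspace. -/
structure FaithfulFrame (A : NonUnitalStarSubalgebra ℂ (H →L[ℂ] H)) where
  /-- the number of vectors -/
  m : ℕ
  /-- the vectors -/
  e : Fin m → H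
  expand : ∀ (a : A) k, (a : H →L[ℂ] H) (e k) = ∑ l, inner ℂ (e l) ((a : H →L[ℂ] H) (e k)) • e l
  faithful : ∀ a : A, (∀ k, (a : H →L[ℂ] H) (e k) = 0) → a = 0

variable {A : NonUnitalStarSubalgebra ℂ (H →L[ℂ] H)}

variable (A) in
/-- Evaluation at a vector. -/
def evalAt (ξ : H) : A →ₗ[ℂ] H where
  toFun a := (a : H →L[ℂ] H) ξ
  map_add' _ _ := rfl
  map_smul' _ _ := rfl

theorem evalAt_apply (ξ : H) (a : A) : evalAt A ξ a = (a : H →L[ℂ] H) ξ := rfl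

/-- A finite set of vectors whose annihilator in `A` has least dimension is separating. -/
theorem exists_finset_separating [FiniteDimensional ℂ A] :
    ∃ s : Finset H, ∀ a : A, (∀ ξ ∈ s, (a : H →L[ℂ] H) ξ = 0) → a = 0 := by
  classical
  let W : Finset H → Submodule ℂ A := fun s => ⨅ ξ ∈ s, LinearMap.ker (evalAt A ξ)
  have hW : ∀ s a, a ∈ W s ↔ ∀ ξ ∈ s, (a : H →L[ℂ] H) ξ = 0 := fun s a => by
    simp [W, evalAt_apply]
  obtain ⟨s, hs⟩ : ∃ s, ∀ t, Module.finrank ℂ (W s) ≤ Module.finrank ℂ (W t) :=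
    ⟨Function.argmin fun s => Module.finrank ℂ (W s),
      fun t => Function.argmin_le (fun s => Module.finrank ℂ (W s)) t⟩
  refine ⟨s, fun a ha => ?_⟩
  by_contra h0
  obtain ⟨ξ, hξ⟩ : ∃ ξ, (a : H →L[ℂ] H) ξ ≠ 0 := by
    by_contra! h
    exact h0 (Subtype.ext (ContinuousLinearMap.ext h))
  have hlt : W (insert ξ s) < W s := by
    refine lt_of_le_of_ne (fun b hb => (hW _ _).2 fun η hη =>
      (hW _ _).1 hb η (Finset.mem_insert_of_mem hη)) fun h => hξ ?_
    have : a ∈ W (insert ξ s) := by rw [h]; exact (hW _ _).2 ha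
    exact (hW _ _).1 this ξ (Finset.mem_insert_self _ _)
  exact absurd (hs (insert ξ s)) (not_le.2 (Submodule.finrank_lt_finrank_of_lt hlt))

/-- A finite-dimensional algebra acts faithfully on some finite-dimensional invariant subspace. -/
theorem nonempty_faithfulFrame [FiniteDimensional ℂ A] : Nonempty (FaithfulFrame A) := by
  classical
  obtain ⟨s, hs⟩ := exists_finset_separating (A := A)
  let H₀ : Submodule ℂ H := s.sup fun ξ => Submodule.span ℂ {ξ} ⊔ LinearMap.range (evalAt A ξ)
  have hfd : FiniteDimensional ℂ H₀ := Submodule.finiteDimensional_finset_sup _ _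
  have hle : ∀ ξ ∈ s, Submodule.span ℂ {ξ} ⊔ LinearMap.range (evalAt A ξ) ≤ H₀ := fun ξ hξ =>
    Finset.le_sup (f := fun ξ => Submodule.span ℂ {ξ} ⊔ LinearMap.range (evalAt A ξ)) hξ
  have hinv : ∀ (a : A), ∀ z ∈ H₀, (a : H →L[ℂ] H) z ∈ H₀ := by
    intro a
    have : H₀ ≤ H₀.comap (a : H →L[ℂ] H).toLinearMap := by
      refine Finset.sup_le fun ξ hξ => sup_le ?_ ?_
      · rw [Submodule.span_singleton_le_iff_mem]
        exact hle ξ hξ (Submodule.mem_sup_right ⟨a, rfl⟩)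
      · rintro _ ⟨b, rfl⟩
        exact hle ξ hξ (Submodule.mem_sup_right ⟨a * b, rfl⟩)
    exact this
  let b := stdOrthonormalBasis ℂ H₀
  have hexp : ∀ z ∈ H₀, z = ∑ l, inner ℂ (b l : H) z • (b l : H) := by
    intro z hz
    have h := congrArg Subtype.val (b.sum_repr' ⟨z, hz⟩)
    simp only [AddSubmonoidClass.coe_finsetSum, SetLike.val_smul, Submodule.coe_inner] at h
    exact h.symm
  refine ⟨⟨_, fun k => b k, fun a k => hexp _ (hinv a _ (b k).2), fun a ha => hs a fun ξ hξ => ?_⟩⟩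
  rw [hexp ξ (hle ξ hξ (Submodule.mem_sup_left (Submodule.mem_span_singleton_self ξ))), map_sum]
  exact Finset.sum_eq_zero fun l _ => by rw [map_smul, ha, smul_zero]

/-- A faithful representation of a finite-dimensional C*-algebra reflects positivity, its range
being closed under square roots. -/
theorem isPositive_of_map_nonneg [FiniteDimensional ℂ A] {K : Type*} [NormedAddCommGroup K]
    [InnerProductSpace ℂ K] [CompleteSpace K] {ρ : A →⋆ₙₐ[ℂ] (K →L[ℂ] K)}
    (hρ : Function.Injective ρ) {a : A} (ha : 0 ≤ ρ a) : (a : H →L[ℂ] H).IsPositive := by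
  have hr : IsClosed (NonUnitalStarAlgHom.range ρ : Set (K →L[ℂ] K)) :=
    Submodule.closed_of_finiteDimensional
      (LinearMap.range (LinearMapClass.linearMap ρ : A →ₗ[ℂ] (K →L[ℂ] K)))
  have hmem : cfcₙ Real.sqrt (ρ a) ∈ NonUnitalStarAlgHom.range ρ :=
    cfcₙ_mem Real.sqrt (NonUnitalStarAlgHom.mem_range_self ρ a)
  rw [← CFC.sqrt_eq_real_sqrt (ρ a) ha] at hmem
  obtain ⟨s, hs⟩ := hmem
  have hs' : ρ s = CFC.sqrt (ρ a) := hs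
  have h : a = star s * s := by
    apply hρ
    rw [map_mul, map_star, hs', (CFC.sqrt_nonneg (ρ a)).isSelfAdjoint.star_eq,
      CFC.sqrt_mul_sqrt_self _ ha]
  rw [← ContinuousLinearMap.nonneg_iff_isPositive, h]
  exact star_mul_self_nonneg (s : H →L[ℂ] H)

section HilbertPower

variable {E F : Type*} [NormedAddCommGroup E] [InnerProductSpace ℂ E]
  [NormedAddCommGroup F] [InnerProductSpace ℂ F] {m : ℕ}

/-- The Hilbertian direct sum `E^m`, as a type of its own: with `PiLp` unfoldable, the unification
of instances on operator spaces becomes expensive. -/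
def HilbertPower (m : ℕ) (E : Type*) : Type _ := PiLp 2 (fun _ : Fin m => E)

namespace HilbertPower

instance : NormedAddCommGroup (HilbertPower m E) :=
  inferInstanceAs (NormedAddCommGroup (PiLp 2 fun _ : Fin m => E))

instance : InnerProductSpace ℂ (HilbertPower m E) :=
  inferInstanceAs (InnerProductSpace ℂ (PiLp 2 fun _ : Fin m => E))

instance [CompleteSpace E] : CompleteSpace (HilbertPower m E) :=
  inferInstanceAs (CompleteSpace (PiLp 2 fun _ : Fin m => E))

instance [SeparableSpace E] : SeparableSpace (HilbertPower m E) :=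
  (WithLp.toLp_surjective 2).denseRange.separableSpace
    (PiLp.continuous_toLp 2 fun _ : Fin m => E)

/-- The coordinate projections. -/
def coord (k : Fin m) : HilbertPower m E →L[ℂ] E := PiLp.proj 2 (fun _ : Fin m => E) k

/-- The coordinate inclusions. -/
def incl (k : Fin m) : E →L[ℂ] HilbertPower m E :=
  (PiLp.continuousLinearEquiv 2 ℂ (fun _ : Fin m => E)).symm.toContinuousLinearMap ∘L
    ContinuousLinearMap.single ℂ (fun _ : Fin m => E) k

/-- The vector with given coordinates. -/
def mk (z : Fin m → E) : HilbertPower m E := WithLp.toLp 2 z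

theorem coord_mk (z : Fin m → E) (k : Fin m) : coord k (mk z) = z k := rfl

theorem coord_incl (k l : Fin m) (x : E) : coord k (incl l x) = if k = l then x else 0 :=
  Pi.single_apply l x k

theorem ext {z w : HilbertPower m E} (h : ∀ k, coord k z = coord k w) : z = w :=
  PiLp.ext h

theorem inner_eq (z w : HilbertPower m E) : inner ℂ z w = ∑ k, inner ℂ (coord k z) (coord k w) :=
  PiLp.inner_apply z w

theorem norm_sq_eq (z : HilbertPower m E) : ‖z‖ ^ 2 = ∑ k, ‖coord k z‖ ^ 2 :=
  PiLp.norm_sq_eq_of_L2 _ z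

end HilbertPower

open HilbertPower

variable (m) in
/-- The diagonal operator `S ⊕ ⋯ ⊕ S`. -/
def diagOp (S : E →L[ℂ] F) : HilbertPower m E →L[ℂ] HilbertPower m F := ∑ k, incl k ∘L S ∘L coord k

theorem coord_diagOp (S : E →L[ℂ] F) (z : HilbertPower m E) (k : Fin m) :
    coord k (diagOp m S z) = S (coord k z) := by
  simp [diagOp, coord_incl]

theorem norm_diagOp_le (S : E →L[ℂ] F) : ‖diagOp m S‖ ≤ ‖S‖ := by
  refine ContinuousLinearMap.opNorm_le_bound _ (norm_nonneg S) fun z => ?_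
  refine le_of_sq_le_sq ?_ (by positivity)
  rw [mul_pow, norm_sq_eq, norm_sq_eq, Finset.mul_sum]
  refine Finset.sum_le_sum fun k _ => ?_
  rw [coord_diagOp, ← mul_pow]
  exact pow_le_pow_left₀ (norm_nonneg _) (S.le_opNorm _) 2

end HilbertPower

namespace FaithfulFrame

open HilbertPower

variable (F : FaithfulFrame A) {E : Type*} [NormedAddCommGroup E] [InnerProductSpace ℂ E]

variable (E) in
/-- The right action of `c ∈ A` on `E^m` through the scalar matrix of `c` in the frame. -/
def rightAct (c : A) : HilbertPower F.m E →L[ℂ] HilbertPower F.m E :=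
  ∑ k, ∑ l, (inner ℂ (F.e l) ((c : H →L[ℂ] H) (F.e k)) : ℂ) •
    (incl k ∘L (coord l : HilbertPower F.m E →L[ℂ] E))

theorem coord_rightAct (c : A) (z : HilbertPower F.m E) (k : Fin F.m) :
    coord k (F.rightAct E c z) =
      ∑ l, (inner ℂ (F.e l) ((c : H →L[ℂ] H) (F.e k)) : ℂ) • coord l z := by
  simp [rightAct, coord_incl]

theorem inner_rightAct (c : A) (z w : HilbertPower F.m E) :
    inner ℂ z (F.rightAct E c w) = inner ℂ (F.rightAct E (star c) z) w := by
  simp only [HilbertPower.inner_eq, coord_rightAct, sum_inner, inner_sum, inner_smul_left,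
    inner_smul_right]
  rw [Finset.sum_comm]
  refine Finset.sum_congr rfl fun k _ => Finset.sum_congr rfl fun l _ => ?_
  rw [StarMemClass.coe_star, ContinuousLinearMap.star_eq_adjoint,
    ContinuousLinearMap.adjoint_inner_right, inner_conj_symm]

theorem diagOp_rightAct {E' : Type*} [NormedAddCommGroup E'] [InnerProductSpace ℂ E']
    (S : E →L[ℂ] E') (c : A) (z : HilbertPower F.m E) :
    diagOp F.m S (F.rightAct E c z) = F.rightAct E' c (diagOp F.m S z) := by
  refine HilbertPower.ext fun k => ?_
  simp only [coord_diagOp, coord_rightAct, map_sum, map_smul]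

/-- The columns `(a e_k)_k` of an element of `A`. -/
def col : A →ₗ[ℂ] HilbertPower F.m H where
  toFun a := HilbertPower.mk fun k => (a : H →L[ℂ] H) (F.e k)
  map_add' _ _ := rfl
  map_smul' _ _ := rfl

theorem coord_col (a : A) (k : Fin F.m) : coord k (F.col a) = (a : H →L[ℂ] H) (F.e k) := rfl

theorem col_injective : Function.Injective F.col := by
  rw [← LinearMap.ker_eq_bot, LinearMap.ker_eq_bot']
  intro a ha
  refine F.faithful a fun k => ?_
  rw [← coord_col, ha, map_zero]

theorem rightAct_col (b c : A) : F.rightAct H c (F.col b) = F.col (b * c) := by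
  refine HilbertPower.ext fun k => ?_
  rw [coord_rightAct, coord_col]
  simp only [coord_col, MulMemClass.coe_mul, mul_apply_eq_comp]
  conv_rhs => rw [F.expand c k, map_sum]
  simp only [map_smul]

theorem inner_col_mul (a b c : A) :
    inner ℂ (F.col b) (F.col (a * c)) = inner ℂ (F.col (star a * b)) (F.col c) := by
  simp only [HilbertPower.inner_eq, coord_col, MulMemClass.coe_mul, mul_apply_eq_comp,
    StarMemClass.coe_star, ContinuousLinearMap.star_eq_adjoint,
    ContinuousLinearMap.adjoint_inner_left]

/-- The Hilbert space `L²(A, τ)` of the faithful trace `τ(a) = ∑ₖ ⟨e_k, a e_k⟩`, realised as the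
space of columns `(a e_k)_k`. -/
def l2 : Submodule ℂ (HilbertPower F.m H) := LinearMap.range F.col

/-- The linear isomorphism of `A` with `L²(A, τ)`. -/
def toL2 : A ≃ₗ[ℂ] F.l2 := LinearEquiv.ofInjective F.col F.col_injective

theorem coe_toL2 (a : A) : (F.toL2 a : HilbertPower F.m H) = F.col a := rfl

theorem inner_toL2_mul (a b c : A) :
    inner ℂ (F.toL2 b) (F.toL2 (a * c)) = inner ℂ (F.toL2 (star a * b)) (F.toL2 c) :=
  F.inner_col_mul a b c

theorem inner_toL2_mul_right (b c d : A) :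
    inner ℂ (F.toL2 b) (F.toL2 (d * c)) = inner ℂ (F.toL2 (b * star c)) (F.toL2 d) := by
  rw [Submodule.coe_inner, Submodule.coe_inner, coe_toL2, coe_toL2, coe_toL2, coe_toL2,
    ← rightAct_col, ← rightAct_col, inner_rightAct]

variable [FiniteDimensional ℂ A]

instance : FiniteDimensional ℂ F.l2 := F.toL2.finiteDimensional

instance : CompleteSpace F.l2 := FiniteDimensional.complete ℂ F.l2

/-- The left regular representation of `A` on `L²(A, τ)`. -/
def leftReg : A →⋆ₙₐ[ℂ] (F.l2 →L[ℂ] F.l2) where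
  toFun a := LinearMap.toContinuousLinearMap
    (F.toL2.toLinearMap ∘ₗ LinearMap.mulLeft ℂ a ∘ₗ F.toL2.symm.toLinearMap)
  map_smul' c a := by
    ext1 x
    change F.toL2 ((c • a) * F.toL2.symm x) = c • F.toL2 (a * F.toL2.symm x)
    rw [smul_mul_assoc, map_smul]
  map_zero' := by
    ext1 x
    change F.toL2 (0 * F.toL2.symm x) = 0
    rw [zero_mul, map_zero]
  map_add' a b := by
    ext1 x
    change F.toL2 ((a + b) * F.toL2.symm x) = F.toL2 (a * F.toL2.symm x) + F.toL2 (b * F.toL2.symm x)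
    rw [add_mul, map_add]
  map_mul' a b := by
    ext1 x
    change F.toL2 (a * b * F.toL2.symm x) =
      F.toL2 (a * F.toL2.symm (F.toL2 (b * F.toL2.symm x)))
    rw [LinearEquiv.symm_apply_apply, mul_assoc]
  map_star' a := by
    ext1 x
    refine ext_inner_left ℂ fun y => ?_
    rw [ContinuousLinearMap.star_eq_adjoint, ContinuousLinearMap.adjoint_inner_right]
    obtain ⟨b, rfl⟩ := F.toL2.surjective x
    obtain ⟨c, rfl⟩ := F.toL2.surjective y
    change inner ℂ (F.toL2 c) (F.toL2 (star a * F.toL2.symm (F.toL2 b))) =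
      inner ℂ (F.toL2 (a * F.toL2.symm (F.toL2 c))) (F.toL2 b)
    rw [LinearEquiv.symm_apply_apply, LinearEquiv.symm_apply_apply, inner_toL2_mul, star_star]

theorem leftReg_apply (a b : A) : F.leftReg a (F.toL2 b) = F.toL2 (a * b) := by
  change F.toL2 (a * F.toL2.symm (F.toL2 b)) = _
  rw [LinearEquiv.symm_apply_apply]

theorem leftReg_injective : Function.Injective F.leftReg := by
  refine (injective_iff_map_eq_zero F.leftReg).2 fun a ha => ?_
  have h : a * star a = 0 := by
    apply F.toL2.injective
    rw [← leftReg_apply, ha, map_zero]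
    rfl
  have h' : (a : H →L[ℂ] H) * star (a : H →L[ℂ] H) = 0 := congrArg Subtype.val h
  exact Subtype.ext ((CStarRing.mul_star_self_eq_zero_iff _).1 h')

theorem norm_leftReg (hA : IsClosed (A : Set (H →L[ℂ] H))) (a : A) : ‖F.leftReg a‖ = ‖a‖ := by
  have := hA
  exact NonUnitalStarAlgHom.norm_map F.leftReg F.leftReg_injective a

/-- A finite-dimensional C*-algebra has a unit: it is the projection of the column `(e_k)_k` of the
identity operator onto `L²(A, τ)`. -/
theorem exists_unit (F : FaithfulFrame A) : ∃ u : A, (∀ c, c * u = c) ∧ ∀ c, u * c = c := by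
  let z : HilbertPower F.m H := HilbertPower.mk F.e
  let u : A := F.toL2.symm (F.l2.orthogonalProjectionOnto z)
  have hu : ∀ b, inner ℂ (F.toL2 b) (F.toL2 u) = inner ℂ (F.col b) z := by
    intro b
    rw [LinearEquiv.apply_symm_apply]
    exact Submodule.inner_orthogonalProjectionOnto_eq_of_mem_left (F.toL2 b) z
  have h1 : ∀ c, c * u = c := by
    intro c
    apply F.toL2.injective
    refine ext_inner_left ℂ fun y => ?_
    obtain ⟨b, rfl⟩ := F.toL2.surjective y
    rw [inner_toL2_mul, hu, Submodule.coe_inner, coe_toL2, coe_toL2]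
    simp only [HilbertPower.inner_eq, coord_col, coord_mk, MulMemClass.coe_mul, mul_apply_eq_comp,
      StarMemClass.coe_star, ContinuousLinearMap.star_eq_adjoint,
      ContinuousLinearMap.adjoint_inner_left, z]
  have h2 : ∀ c, star u * c = c := fun c => by
    have := congrArg star (h1 (star c))
    rwa [star_mul, star_star] at this
  have h3 : star u = u := (h1 (star u)).symm.trans (h2 u)
  exact ⟨u, h1, fun c => by rw [← h3, h2]⟩

end FaithfulFrame

end FiniteDimensional

/-! ### Bimodules of intertwiners -/

section BimoduleOfRepresentation

variable {H : Type u} [NormedAddCommGroup H] [InnerProductSpace ℂ H] [CompleteSpace H]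
  {A : NonUnitalStarSubalgebra ℂ (H →L[ℂ] H)}

section Intertwiners

variable {E G : Type*} [NormedAddCommGroup E] [InnerProductSpace ℂ E]
  [NormedAddCommGroup G] [InnerProductSpace ℂ G] {ι : Type*}

/-- The operators intertwining two families of operators. -/
def intertwiners (r : ι → (E →L[ℂ] E)) (s : ι → (G →L[ℂ] G)) : Submodule ℂ (E →L[ℂ] G) where
  carrier := {T | ∀ c, T ∘L r c = s c ∘L T}
  add_mem' hS hT c := by
    rw [ContinuousLinearMap.add_comp, ContinuousLinearMap.comp_add, hS, hT]
  zero_mem' c := by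
    rw [ContinuousLinearMap.zero_comp, ContinuousLinearMap.comp_zero]
  smul_mem' a T hT c := by
    rw [ContinuousLinearMap.smul_comp, ContinuousLinearMap.comp_smul, hT]

variable {r : ι → (E →L[ℂ] E)} {s : ι → (G →L[ℂ] G)}

theorem isClosed_intertwiners : IsClosed (intertwiners r s : Set (E →L[ℂ] G)) := by
  have : (intertwiners r s : Set (E →L[ℂ] G)) = ⋂ c, {T | T ∘L r c = s c ∘L T} := by
    ext T
    rw [Set.mem_iInter]
    exact Iff.rfl
  rw [this]
  exact isClosed_iInter fun c => isClosed_eq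
    (((ContinuousLinearMap.compL ℂ E E G).flip (r c)).continuous)
    ((ContinuousLinearMap.compL ℂ E G G (s c)).continuous)

/-- Precomposition of an intertwiner with an operator commuting with the first family. -/
def intertwiners.precomp (T : intertwiners r s) (a : E →L[ℂ] E) (ha : ∀ c, a ∘L r c = r c ∘L a) :
    intertwiners r s :=
  ⟨T.1 ∘L a, fun c => by
    rw [ContinuousLinearMap.comp_assoc, ha, ← ContinuousLinearMap.comp_assoc, T.2,
      ContinuousLinearMap.comp_assoc]⟩

/-- Postcomposition of an intertwiner with an operator commuting with the second family. -/
def intertwiners.postcomp (T : intertwiners r s) (a : G →L[ℂ] G) (ha : ∀ c, a ∘L s c = s c ∘L a) :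
    intertwiners r s :=
  ⟨a ∘L T.1, fun c => by
    rw [ContinuousLinearMap.comp_assoc, T.2, ← ContinuousLinearMap.comp_assoc, ha,
      ContinuousLinearMap.comp_assoc]⟩

theorem completeSpace_intertwiners [CompleteSpace G] : CompleteSpace (intertwiners r s) := by
  have h : IsClosed (intertwiners r s : Set (E →L[ℂ] G)) := isClosed_intertwiners
  exact completeSpace_coe_iff_isComplete.2 h.isComplete

variable [CompleteSpace E] [CompleteSpace G]

/-- For intertwiners `S` and `T`, the operator `S*T` commutes with the first family. -/
theorem intertwiners.adjoint_comp_comm {r : A → (E →L[ℂ] E)} {s : A → (G →L[ℂ] G)}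
    (hr : ∀ c, ContinuousLinearMap.adjoint (r c) = r (star c))
    (hs : ∀ c, ContinuousLinearMap.adjoint (s c) = s (star c)) (S T : intertwiners r s) (c : A) :
    (ContinuousLinearMap.adjoint S.1 ∘L T.1) ∘L r c =
      r c ∘L (ContinuousLinearMap.adjoint S.1 ∘L T.1) := by
  have h := congrArg ContinuousLinearMap.adjoint (S.2 (star c))
  rw [ContinuousLinearMap.adjoint_comp, ContinuousLinearMap.adjoint_comp, hr, hs, star_star] at h
  rw [ContinuousLinearMap.comp_assoc, T.2, ← ContinuousLinearMap.comp_assoc, ← h,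
    ContinuousLinearMap.comp_assoc]

variable (A E) in
/-- A standard form of `A`: a faithful representation `left` of `A` on a Hilbert space whose range
is the commutant of a self-adjoint family `right` of operators indexed by `A`. -/
structure StandardForm where
  /-- the representation -/
  left : A →⋆ₙₐ[ℂ] (E →L[ℂ] E)
  /-- the family generating the commutant -/
  right : A → (E →L[ℂ] E)
  adjoint_right : ∀ c, ContinuousLinearMap.adjoint (right c) = right (star c)
  left_comp_right : ∀ a c, left a ∘L right c = right c ∘L left a
  exists_left : ∀ T, (∀ c, T ∘L right c = right c ∘L T) → ∃ a, left a = T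
  norm_left : ∀ a, ‖left a‖ = ‖a‖
  isPositive : ∀ a, 0 ≤ left a → (a : H →L[ℂ] H).IsPositive

namespace StandardForm

variable (P : StandardForm A E) {s : A → (G →L[ℂ] G)}

theorem left_injective : Function.Injective P.left :=
  (injective_iff_map_eq_zero P.left).2 fun a ha => by
    rw [← norm_eq_zero, ← P.norm_left, ha, norm_zero]

/-- The `A`-valued inner product `S*T` of intertwiners. -/
def homInner (hs : ∀ c, ContinuousLinearMap.adjoint (s c) = s (star c))
    (S T : intertwiners P.right s) : A :=
  (P.exists_left _ (intertwiners.adjoint_comp_comm P.adjoint_right hs S T)).choose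

variable (hs : ∀ c, ContinuousLinearMap.adjoint (s c) = s (star c))

theorem left_homInner (S T : intertwiners P.right s) :
    P.left (P.homInner hs S T) = ContinuousLinearMap.adjoint S.1 ∘L T.1 :=
  (P.exists_left _ (intertwiners.adjoint_comp_comm P.adjoint_right hs S T)).choose_spec

/-- The right action `T · a = T ∘ left(a)`. -/
def homRsmul : intertwiners P.right s →ₗ[ℂ] A →ₗ[ℂ] intertwiners P.right s :=
  LinearMap.mk₂ ℂ (fun T a => intertwiners.precomp T (P.left a) (P.left_comp_right a))
    (fun S T a => Subtype.ext (ContinuousLinearMap.add_comp _ _ _))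
    (fun c T a => Subtype.ext (ContinuousLinearMap.smul_comp _ _ _))
    (fun T a b => Subtype.ext (by
      change T.1 ∘L P.left (a + b) = T.1 ∘L P.left a + T.1 ∘L P.left b
      rw [map_add, ContinuousLinearMap.comp_add]))
    (fun c T a => Subtype.ext (by
      change T.1 ∘L P.left (c • a) = c • T.1 ∘L P.left a
      rw [map_smul, ContinuousLinearMap.comp_smul]))

theorem coe_homRsmul (T : intertwiners P.right s) (a : A) :
    (P.homRsmul T a : E →L[ℂ] G) = T.1 ∘L P.left a := rfl

/-- The left action through a representation commuting with the second family. -/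
def homLsmul (σ : A →⋆ₙₐ[ℂ] (G →L[ℂ] G)) (hσ : ∀ a c, σ a ∘L s c = s c ∘L σ a) :
    A →ₗ[ℂ] intertwiners P.right s →ₗ[ℂ] intertwiners P.right s :=
  LinearMap.mk₂ ℂ (fun a T => intertwiners.postcomp T (σ a) (hσ a))
    (fun a b T => Subtype.ext (by
      change σ (a + b) ∘L T.1 = σ a ∘L T.1 + σ b ∘L T.1
      rw [map_add, ContinuousLinearMap.add_comp]))
    (fun c a T => Subtype.ext (by
      change σ (c • a) ∘L T.1 = c • σ a ∘L T.1
      rw [map_smul, ContinuousLinearMap.smul_comp]))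
    (fun a S T => Subtype.ext (ContinuousLinearMap.comp_add _ _ _))
    (fun c a T => Subtype.ext (ContinuousLinearMap.comp_smul _ _ _))

variable (σ : A →⋆ₙₐ[ℂ] (G →L[ℂ] G)) (hσ : ∀ a c, σ a ∘L s c = s c ∘L σ a)

theorem coe_homLsmul (a : A) (T : intertwiners P.right s) :
    (P.homLsmul σ hσ a T : E →L[ℂ] G) = σ a ∘L T.1 := rfl

/-- The intertwiners from a standard form of `A` to another representation of the commutant form a
Hilbert `A`-bimodule. -/
def homBimodule : HilbertBimodule A (intertwiners P.right s) where
  rsmul := P.homRsmul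
  inner := P.homInner hs
  lsmul := P.homLsmul σ hσ
  rsmul_mul x a b := Subtype.ext (by
    rw [coe_homRsmul, coe_homRsmul, coe_homRsmul, map_mul]; rfl)
  inner_add_right x y z := P.left_injective (by
    rw [map_add, left_homInner, left_homInner, left_homInner]
    exact ContinuousLinearMap.comp_add _ _ _)
  inner_smul_right c x y := P.left_injective (by
    rw [map_smul, left_homInner, left_homInner]
    exact ContinuousLinearMap.comp_smul _ _ _)
  inner_rsmul_right x y a := P.left_injective (by
    rw [map_mul, left_homInner, left_homInner, coe_homRsmul]; rfl)
  star_inner x y := P.left_injective (by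
    rw [map_star, left_homInner, left_homInner, ContinuousLinearMap.star_eq_adjoint,
      ContinuousLinearMap.adjoint_comp, ContinuousLinearMap.adjoint_adjoint])
  inner_self_nonneg x := P.isPositive _ (by
    rw [left_homInner, ContinuousLinearMap.nonneg_iff_isPositive]
    exact ContinuousLinearMap.isPositive_adjoint_comp_self x.1)
  norm_sq_eq x := by
    rw [← P.norm_left, left_homInner, ContinuousLinearMap.norm_adjoint_comp_self, pow_two]
    rfl
  lsmul_mul a b x := Subtype.ext (by
    rw [coe_homLsmul, coe_homLsmul, coe_homLsmul, map_mul]; rfl)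
  inner_lsmul_left a x y := P.left_injective (by
    rw [left_homInner, left_homInner, coe_homLsmul, coe_homLsmul, map_star,
      ContinuousLinearMap.star_eq_adjoint, ContinuousLinearMap.adjoint_comp,
      ContinuousLinearMap.comp_assoc])

theorem countablyGenerated_homBimodule [FiniteDimensional ℂ E] [SeparableSpace G] {u : A}
    (hu : P.left u = ContinuousLinearMap.id ℂ E) :
    (P.homBimodule hs σ hσ).CountablyGenerated := by
  have : SecondCountableTopology G := UniformSpace.secondCountable_of_separable G
  obtain ⟨t, ht, hd⟩ := TopologicalSpace.exists_countable_dense (intertwiners P.right s)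
  refine ⟨t, ht, hd.mono fun x hx => Submodule.subset_span ⟨x, hx, u, Subtype.ext ?_⟩⟩
  change x.1 = x.1 ∘L P.left u
  rw [hu, ContinuousLinearMap.comp_id]

end StandardForm

/-- A bounded linear map `Ψ` of `B(H, K)` into a bimodule with `⟨Ψ(W), a · Ψ(V)⟩ = W* ρ(a) V`
turns a representation into a bimodule representation. -/
theorem HilbertBimodule.hasBimoduleRepresentation {N K : Type u}
    [NormedAddCommGroup N] [NormedSpace ℂ N] [CompleteSpace N] (B : HilbertBimodule A N)
    (hB : B.CountablyGenerated) [NormedAddCommGroup K] [InnerProductSpace ℂ K] [CompleteSpace K]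
    (ρ : A →⋆ₙₐ[ℂ] (K →L[ℂ] K)) (Ψ : (H →L[ℂ] K) →L[ℂ] N)
    (hΨ : ∀ (V W : H →L[ℂ] K) (a b : A),
      (b : H →L[ℂ] H) = ContinuousLinearMap.adjoint W ∘L ρ a ∘L V →
        b = B.inner (Ψ W) (B.lsmul a (Ψ V)))
    {X Y : Type*} [MeasurableSpace X] [MeasurableSpace Y] {μ : Measure X} {ν : Measure Y}
    {φ : X → Y → CBMap A} {V : X → (H →L[ℂ] K)} {W : Y → (H →L[ℂ] K)}
    (hVb : ∃ M : ℝ, ∀ x, ‖V x‖ ≤ M) (hWb : ∃ M : ℝ, ∀ y, ‖W y‖ ≤ M)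
    (hV : WeaklyMeasurable V μ) (hW : WeaklyMeasurable W ν)
    (h : ∀ a, ∀ᵐ p ∂(μ.prod ν), (φ p.1 p.2 a : H →L[ℂ] H) =
      ContinuousLinearMap.adjoint (W p.2) ∘L ρ a ∘L V p.1) :
    HasBimoduleRepresentation μ ν φ := by
  obtain ⟨M₁, hM₁⟩ := hVb
  obtain ⟨M₂, hM₂⟩ := hWb
  refine ⟨N, inferInstance, inferInstance, inferInstance, B, fun x => Ψ (V x), fun y => Ψ (W y),
    hB, ⟨‖Ψ‖ * M₁, fun x => (Ψ.le_opNorm _).trans (by gcongr; exact hM₁ x)⟩,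
    ⟨‖Ψ‖ * M₂, fun y => (Ψ.le_opNorm _).trans (by gcongr; exact hM₂ y)⟩,
    hV.continuousLinearMap_comp Ψ, hW.continuousLinearMap_comp Ψ, fun a => ?_⟩
  filter_upwards [h a] with p hp
  exact hΨ _ _ _ _ hp

/-- A contractive linear map into operators, with values intertwiners, as a bounded map into the space
of intertwiners. -/
def intertwiners.lift {K : Type u} [NormedAddCommGroup K] [InnerProductSpace ℂ K]
    (Φ : (H →L[ℂ] K) →ₗ[ℂ] (E →L[ℂ] G)) (hΦs : ∀ S c, Φ S ∘L r c = s c ∘L Φ S)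
    (hΦn : ∀ S, ‖Φ S‖ ≤ ‖S‖) : (H →L[ℂ] K) →L[ℂ] intertwiners r s :=
  (Φ.codRestrict (intertwiners r s) hΦs).mkContinuous 1 fun S => by
    rw [one_mul]; exact hΦn S

theorem intertwiners.coe_lift {K : Type u} [NormedAddCommGroup K] [InnerProductSpace ℂ K]
    (Φ : (H →L[ℂ] K) →ₗ[ℂ] (E →L[ℂ] G)) (hΦs : ∀ S c, Φ S ∘L r c = s c ∘L Φ S)
    (hΦn : ∀ S, ‖Φ S‖ ≤ ‖S‖) (S : H →L[ℂ] K) :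
    (intertwiners.lift Φ hΦs hΦn S : E →L[ℂ] G) = Φ S := rfl

theorem hasBimoduleRepresentation_of_intertwiners {E G K : Type u}
    [NormedAddCommGroup E] [InnerProductSpace ℂ E] [CompleteSpace E] [FiniteDimensional ℂ E]
    [NormedAddCommGroup G] [InnerProductSpace ℂ G] [CompleteSpace G] [SeparableSpace G]
    [NormedAddCommGroup K] [InnerProductSpace ℂ K] [CompleteSpace K]
    (P : StandardForm A E) {u : A} (hu : P.left u = ContinuousLinearMap.id ℂ E)
    {s : A → (G →L[ℂ] G)} (hs : ∀ c, ContinuousLinearMap.adjoint (s c) = s (star c))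
    (σ : A →⋆ₙₐ[ℂ] (G →L[ℂ] G)) (hσ : ∀ a c, σ a ∘L s c = s c ∘L σ a)
    (ρ : A →⋆ₙₐ[ℂ] (K →L[ℂ] K)) (Φ : (H →L[ℂ] K) →ₗ[ℂ] (E →L[ℂ] G))
    (hΦs : ∀ S c, Φ S ∘L P.right c = s c ∘L Φ S) (hΦn : ∀ S, ‖Φ S‖ ≤ ‖S‖)
    (hΦ : ∀ (V W : H →L[ℂ] K) (a b : A),
      (b : H →L[ℂ] H) = ContinuousLinearMap.adjoint W ∘L ρ a ∘L V →
        P.left b = ContinuousLinearMap.adjoint (Φ W) ∘L σ a ∘L Φ V)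
    {X Y : Type*} [MeasurableSpace X] [MeasurableSpace Y] {μ : Measure X} {ν : Measure Y}
    {φ : X → Y → CBMap A} {V : X → (H →L[ℂ] K)} {W : Y → (H →L[ℂ] K)}
    (hVb : ∃ M : ℝ, ∀ x, ‖V x‖ ≤ M) (hWb : ∃ M : ℝ, ∀ y, ‖W y‖ ≤ M)
    (hV : WeaklyMeasurable V μ) (hW : WeaklyMeasurable W ν)
    (h : ∀ a, ∀ᵐ p ∂(μ.prod ν), (φ p.1 p.2 a : H →L[ℂ] H) =
      ContinuousLinearMap.adjoint (W p.2) ∘L ρ a ∘L V p.1) :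
    HasBimoduleRepresentation μ ν φ := by
  have hc : CompleteSpace (intertwiners P.right s) := completeSpace_intertwiners
  have hi : ∀ (V W : H →L[ℂ] K) (a b : A),
      (b : H →L[ℂ] H) = ContinuousLinearMap.adjoint W ∘L ρ a ∘L V →
        b = P.homInner hs (intertwiners.lift Φ hΦs hΦn W)
          (P.homLsmul σ hσ a (intertwiners.lift Φ hΦs hΦn V)) := fun V W a b hb => by
    apply P.left_injective
    rw [StandardForm.left_homInner, StandardForm.coe_homLsmul, intertwiners.coe_lift,
      intertwiners.coe_lift]
    exact hΦ _ _ _ _ hb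
  exact (P.homBimodule hs σ hσ).hasBimoduleRepresentation
    (P.countablyGenerated_homBimodule hs σ hσ hu) ρ (intertwiners.lift Φ hΦs hΦn) hi hVb hWb hV hW h

end Intertwiners

namespace FaithfulFrame

open HilbertPower

variable (F : FaithfulFrame A) [FiniteDimensional ℂ A]

/-- Right multiplication on `L²(A, τ)`. -/
def rightReg (c : A) : F.l2 →L[ℂ] F.l2 :=
  LinearMap.toContinuousLinearMap
    (F.toL2.toLinearMap ∘ₗ LinearMap.mulRight ℂ c ∘ₗ F.toL2.symm.toLinearMap)

theorem rightReg_apply (b c : A) : F.rightReg c (F.toL2 b) = F.toL2 (b * c) := by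
  change F.toL2 (F.toL2.symm (F.toL2 b) * c) = _
  rw [LinearEquiv.symm_apply_apply]

/-- `A` acting on `L²(A, τ)` by left and right multiplications. -/
def standardForm (hA : IsClosed (A : Set (H →L[ℂ] H))) : StandardForm A F.l2 where
  left := F.leftReg
  right := F.rightReg
  adjoint_right c := by
    ext1 x
    refine ext_inner_left ℂ fun y => ?_
    obtain ⟨b, rfl⟩ := F.toL2.surjective x
    obtain ⟨d, rfl⟩ := F.toL2.surjective y
    rw [ContinuousLinearMap.adjoint_inner_right, rightReg_apply, rightReg_apply,
      inner_toL2_mul_right, star_star]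
  left_comp_right a c := by
    ext1 x
    obtain ⟨b, rfl⟩ := F.toL2.surjective x
    rw [ContinuousLinearMap.comp_apply, ContinuousLinearMap.comp_apply, rightReg_apply,
      leftReg_apply, leftReg_apply, rightReg_apply, mul_assoc]
  exists_left T hT := by
    obtain ⟨u, -, hu⟩ := F.exists_unit
    refine ⟨F.toL2.symm (T (F.toL2 u)), ?_⟩
    ext1 x
    obtain ⟨c, rfl⟩ := F.toL2.surjective x
    have h := congrArg (fun S : F.l2 →L[ℂ] F.l2 => S (F.toL2 u)) (hT c)
    simp only [ContinuousLinearMap.comp_apply, rightReg_apply, hu] at h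
    rw [leftReg_apply, h, ← rightReg_apply, LinearEquiv.apply_symm_apply]
  norm_left := F.norm_leftReg hA
  isPositive a ha := isPositive_of_map_nonneg F.leftReg_injective ha

variable {K : Type u} [NormedAddCommGroup K] [InnerProductSpace ℂ K]

variable (K) in
/-- An operator `S : H → K` acts on the columns in `L²(A, τ)` entrywise. -/
def columnMap : (H →L[ℂ] K) →ₗ[ℂ] (F.l2 →L[ℂ] HilbertPower F.m K) where
  toFun S := diagOp F.m S ∘L F.l2.subtypeL
  map_add' S T := ContinuousLinearMap.ext fun x => HilbertPower.ext fun k => by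
    change coord k (diagOp F.m (S + T) x) = coord k (diagOp F.m S x + diagOp F.m T x)
    rw [map_add, coord_diagOp, coord_diagOp, coord_diagOp, add_apply]
  map_smul' c S := ContinuousLinearMap.ext fun x => HilbertPower.ext fun k => by
    change coord k (diagOp F.m (c • S) x) = coord k (c • diagOp F.m S x)
    rw [map_smul, coord_diagOp, coord_diagOp, smul_apply]

theorem columnMap_toL2 (S : H →L[ℂ] K) (b : A) :
    F.columnMap K S (F.toL2 b) = diagOp F.m S (F.col b) := rfl

theorem columnMap_comp_rightReg (S : H →L[ℂ] K) (c : A) :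
    F.columnMap K S ∘L F.rightReg c = F.rightAct K c ∘L F.columnMap K S := by
  ext1 x
  obtain ⟨b, rfl⟩ := F.toL2.surjective x
  rw [ContinuousLinearMap.comp_apply, ContinuousLinearMap.comp_apply, rightReg_apply,
    columnMap_toL2, columnMap_toL2, ← rightAct_col, diagOp_rightAct]

theorem norm_columnMap_le (S : H →L[ℂ] K) : ‖F.columnMap K S‖ ≤ ‖S‖ := by
  refine ContinuousLinearMap.opNorm_le_bound _ (norm_nonneg S) fun x => ?_
  exact (diagOp F.m S).le_of_opNorm_le (norm_diagOp_le S) (x : HilbertPower F.m H)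

variable [CompleteSpace K]

theorem adjoint_rightAct (c : A) :
    ContinuousLinearMap.adjoint (F.rightAct K c) = F.rightAct K (star c) := by
  ext1 z
  refine ext_inner_left ℂ fun w => ?_
  rw [ContinuousLinearMap.adjoint_inner_right, inner_rightAct, star_star]

/-- The representation `a ↦ ρ(a) ⊕ ⋯ ⊕ ρ(a)`. -/
def diagRep (ρ : A →⋆ₙₐ[ℂ] (K →L[ℂ] K)) :
    A →⋆ₙₐ[ℂ] (HilbertPower F.m K →L[ℂ] HilbertPower F.m K) where
  toFun a := diagOp F.m (ρ a)
  map_smul' c a := by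
    ext1 z
    refine HilbertPower.ext fun k => ?_
    rw [coord_diagOp, smul_apply, map_smul, map_smul, coord_diagOp, smul_apply]
    rfl
  map_zero' := by
    ext1 z
    refine HilbertPower.ext fun k => ?_
    rw [coord_diagOp, zero_apply, map_zero, map_zero, zero_apply]
  map_add' a b := by
    ext1 z
    refine HilbertPower.ext fun k => ?_
    rw [coord_diagOp, add_apply, map_add, map_add, coord_diagOp, coord_diagOp, add_apply]
  map_mul' a b := by
    ext1 z
    refine HilbertPower.ext fun k => ?_
    rw [coord_diagOp, mul_apply_eq_comp, coord_diagOp, coord_diagOp, map_mul, mul_apply_eq_comp]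
  map_star' a := by
    ext1 z
    refine ext_inner_left ℂ fun w => ?_
    rw [ContinuousLinearMap.star_eq_adjoint, ContinuousLinearMap.adjoint_inner_right]
    simp only [HilbertPower.inner_eq, coord_diagOp]
    refine Finset.sum_congr rfl fun k _ => ?_
    rw [map_star, ContinuousLinearMap.star_eq_adjoint, ContinuousLinearMap.adjoint_inner_right]

theorem diagRep_comp_rightAct (ρ : A →⋆ₙₐ[ℂ] (K →L[ℂ] K)) (a c : A) :
    F.diagRep ρ a ∘L F.rightAct K c = F.rightAct K c ∘L F.diagRep ρ a := by
  ext1 z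
  exact F.diagOp_rightAct (ρ a) c z

/-- Left multiplication by `W* ρ(a) V` factors through the column maps of `V` and `W`. -/
theorem leftReg_eq_columnMap (ρ : A →⋆ₙₐ[ℂ] (K →L[ℂ] K)) {V W : H →L[ℂ] K} {a b : A}
    (h : (b : H →L[ℂ] H) = ContinuousLinearMap.adjoint W ∘L ρ a ∘L V) :
    F.leftReg b =
      ContinuousLinearMap.adjoint (F.columnMap K W) ∘L F.diagRep ρ a ∘L F.columnMap K V := by
  ext1 x
  obtain ⟨c, rfl⟩ := F.toL2.surjective x
  refine ext_inner_left ℂ fun y => ?_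
  obtain ⟨d, rfl⟩ := F.toL2.surjective y
  rw [leftReg_apply, ContinuousLinearMap.comp_apply, ContinuousLinearMap.adjoint_inner_right,
    ContinuousLinearMap.comp_apply, columnMap_toL2, columnMap_toL2, Submodule.coe_inner, coe_toL2,
    coe_toL2]
  change inner ℂ (F.col d) (F.col (b * c)) = inner ℂ (diagOp F.m W (F.col d))
    (diagOp F.m (ρ a) (diagOp F.m V (F.col c)))
  rw [HilbertPower.inner_eq, HilbertPower.inner_eq]
  refine Finset.sum_congr rfl fun k _ => ?_
  rw [coord_diagOp, coord_diagOp, coord_diagOp, coord_col, coord_col, coord_col,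
    MulMemClass.coe_mul, mul_apply_eq_comp, h, ContinuousLinearMap.comp_apply,
    ContinuousLinearMap.adjoint_inner_right, ContinuousLinearMap.comp_apply]

end FaithfulFrame

/-- In finite dimension, `V x` and `W y` act on the columns forming `L²(A, τ)`, which makes them
elements of a bimodule of intertwiners. -/
theorem bimodule_of_representation [FiniteDimensional ℂ A]
    {X Y : Type*} [MeasurableSpace X] [MeasurableSpace Y] {μ : Measure X} {ν : Measure Y}
    {φ : X → Y → CBMap A} (hA : IsClosed (A : Set (H →L[ℂ] H)))
    (h : HasWeaklyMeasurableRepresentation μ ν φ) : HasBimoduleRepresentation μ ν φ := by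
  obtain ⟨K, _, _, _, _, ρ, V, W, -, hVb, hWb, hV, hW, hrep⟩ := h
  obtain ⟨F⟩ := nonempty_faithfulFrame (A := A)
  obtain ⟨u, -, hu⟩ := F.exists_unit
  have hu' : F.leftReg u = ContinuousLinearMap.id ℂ F.l2 := by
    ext1 x
    obtain ⟨c, rfl⟩ := F.toL2.surjective x
    rw [FaithfulFrame.leftReg_apply, hu, ContinuousLinearMap.id_apply]
  exact hasBimoduleRepresentation_of_intertwiners (F.standardForm hA) hu' F.adjoint_rightAct
    (F.diagRep ρ) (F.diagRep_comp_rightAct ρ) ρ (F.columnMap K) F.columnMap_comp_rightReg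
    F.norm_columnMap_le (fun V W a b h => F.leftReg_eq_columnMap ρ h) hVb hWb hV hW hrep

end BimoduleOfRepresentation

end SchurMult

end

theorem mainTheorem7 {H : Type u} [NormedAddCommGroup H] [InnerProductSpace ℂ H]
    [CompleteSpace H] [SeparableSpace H]
    (A : NonUnitalStarSubalgebra ℂ (H →L[ℂ] H)) (hA : IsClosed (A : Set (H →L[ℂ] H)))
    [SeparableSpace A]
    {X Y : Type*}
    [TopologicalSpace X] [PolishSpace X] [LocallyCompactSpace X] [MeasurableSpace X] [BorelSpace X]
    [TopologicalSpace Y] [PolishSpace Y] [LocallyCompactSpace Y] [MeasurableSpace Y] [BorelSpace Y]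
    (μ : Measure X) [IsLocallyFiniteMeasure μ] (ν : Measure Y) [IsLocallyFiniteMeasure ν]
    (φ : X → Y → SchurMult.CBMap A) (hφb : SchurMult.IsBoundedFamily φ)
    (hφm : SchurMult.PointwiseMeasurable μ ν φ) :
    (SchurMult.HasBimoduleRepresentation μ ν φ →
      SchurMult.IsSchurMultiplier μ ν φ ∧ SchurMult.HasWeaklyMeasurableRepresentation μ ν φ) ∧
    (FiniteDimensional ℂ A →
      (SchurMult.HasBimoduleRepresentation μ ν φ ↔
        SchurMult.IsSchurMultiplier μ ν φ ∧
          SchurMult.HasWeaklyMeasurableRepresentation μ ν φ)) := by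
  refine ⟨SchurMult.schur_and_representation_of_bimodule hA hφb hφm, fun _ =>
    ⟨SchurMult.schur_and_representation_of_bimodule hA hφb hφm, fun h =>
      SchurMult.bimodule_of_representation hA h.2⟩⟩
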